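/- Let ${\bf u}=2^{-53}$. For a real matrix $A$ with $n$ columns, let $\|A\|_2$ be its largest and $\sigma_{\min}(A)$ its smallest ($n$-th) singular value, and let $\kappa_2(A)=\|A\|_2/\sigma_{\min}(A)$ if $A$ has full column rank. Computations follow the standard model of floating-point arithmetic: each operation $+,-,\times,/,\sqrt{\cdot}$ has relative error at most ${\bf u}$, without underflow or overflow, and sums may be evaluated in any order. $[W,Y]=\mathrm{SCholeskyQR}(X)$ with shift $s>0$ denotes the result of computing, in this arithmetic, $G=X^\top X$, then $G+sI$, its upper triangular Cholesky factor $Y$, and $W=XY^{-1}$ row by row by substitution in triangular systems; $\mathrm{CholeskyQR}$ is the same without the shift. $[Q,Z]=\mathrm{CholeskyQR2}(W)$ means $[V,D]=\mathrm{CholeskyQR}(W)$, $[Q,J]=\mathrm{CholeskyQR}(V)$, $Z=JD$; and $[Q,R]=\mathrm{SCholeskyQR3}(X)$ means $[W,Y]=\mathrm{SCholeskyQR}(X)$, $[Q,Z]=\mathrm{CholeskyQR2}(W)$, $R=ZY$. An execution breaks down if a computed pivot in one of its Cholesky factorizations is not positive. Let $X\in\mathbb R^{m\times n}$ have full column rank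 and be a $T_1$ matrix: for some set of $v$ columns, $0<v<n$, each column in the set has at most $t_1$ nonzero entries and every other column has at most $t_2$ nonzero entries, where $0<t_2<t_1$. Put $$c=\max_{i,j}|x_{ij}|,\quad r=\frac{n\sqrt n}{m\sqrt v},\quad h=\sqrt{2.23+0.34r+0.013r^2},\quad l=\frac{c\sqrt{t_1}}{\|X\|_2},\quad k=\frac{(vt_1+nt_2)c^2}{\|X\|_2^2}.$$ Assume that $$11(m{\bf u}+(n+1){\bf u})(vt_1+nt_2)c^2\le s\le\min\Bigl(\tfrac1{100n}(vt_1+nt_2)c^2,\ \tfrac1{100}t_1c^2\Bigr),\qquad 4n^2{\bf u}\,h\,l\,\kappa_2(X)\le1 .$$ (1) No execution of $\mathrm{SCholeskyQR}(X)$ with shift $s$ breaks down, and for every possible result $[W,Y]$ the matrix $W$ has full column rank and $$\kappa_2(W)\le 2h\sqrt{1+\alpha_0\,\kappa_2(X)^2},\qquad \alpha_0=\frac{s}{\|X\|_2^2}.$$ (2) If $s=11(m{\bf u}+(n+1){\bf u})(vt_1+nt_2)c^2$, then $\alpha_0=11(m{\bf u}+(n+1){\bf u})k$, and $$\kappa_2(X)\le\frac1{16\sqrt{11nk}\,(m{\bf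 u}+(n+1){\bf u})\,h}$$ is a sufficient condition for Shifted CholeskyQR3, in the following sense: under it no execution of $\mathrm{SCholeskyQR3}(X)$ with shift $s$ breaks down, and every computed $W$ satisfies the condition $$\kappa_2(W)\le\frac1{8\sqrt{mn{\bf u}+n(n+1){\bf u}}}$$ required for the subsequent $\mathrm{CholeskyQR2}(W)$. -/

import Mathlib

noncomputable section

namespace SparseCholeskyQR

/-! ### Matrix quantities -/

/-- The machine precision (unit roundoff) of IEEE double precision. -/
def u : ℝ := 2 ^ (-53 : ℤ)

/-- The `2`-norm (largest singular value, i.e. Euclidean operator norm) of a real matrix. -/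
def norm2 {m n : ℕ} (X : Matrix (Fin m) (Fin n) ℝ) : ℝ :=
  ‖(Matrix.toEuclideanLin X).toContinuousLinearMap‖

/-- The smallest of the `n` singular values of a real `m × n` matrix. Mathlib lists the singular
values in decreasing order, starting from index `0`. -/
def sigmaMin {m n : ℕ} (X : Matrix (Fin m) (Fin n) ℝ) : ℝ :=
  (Matrix.toEuclideanLin X).singularValues (n - 1)

/-- The condition number `‖X‖₂ / σ_min(X)`; meaningful for matrices of full column rank. -/
def cond2 {m n : ℕ} (X : Matrix (Fin m) (Fin n) ℝ) : ℝ :=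
  norm2 X / sigmaMin X

/-- The largest absolute value `c` of an entry of `X`. -/
def maxAbsEntry {m n : ℕ} (X : Matrix (Fin m) (Fin n) ℝ) : ℝ :=
  ⨆ p : Fin m × Fin n, |X p.1 p.2|

/-- `X` is a `T₁` matrix with `v > 0` dense columns: outside a set of `v < n` columns, which have
at most `t₁` nonzero entries each, every column has at most `t₂` nonzero entries, `0 < t₂ < t₁`. -/
structure IsT1Matrix {m n : ℕ} (X : Matrix (Fin m) (Fin n) ℝ) (v t₁ t₂ : ℕ) : Prop where
  v_pos : 0 < v
  v_lt : v < n
  t₂_pos : 0 < t₂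
  t₂_lt : t₂ < t₁
  columns : ∃ D : Finset (Fin n), D.card = v ∧
    (∀ j ∈ D, {i | X i j ≠ 0}.ncard ≤ t₁) ∧ (∀ j ∉ D, {i | X i j ≠ 0}.ncard ≤ t₂)

/-- `r = n √n / (m √v)`. -/
def rParam (m n v : ℕ) : ℝ := n * √(n : ℝ) / (m * √(v : ℝ))

/-- `h = √(2.23 + 0.34 r + 0.013 r²)`. -/
def hParam (m n v : ℕ) : ℝ :=
  √(2.23 + 0.34 * rParam m n v + 0.013 * rParam m n v ^ 2)

/-- `l = c √t₁ / ‖X‖₂`. -/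
def lParam {m n : ℕ} (X : Matrix (Fin m) (Fin n) ℝ) (t₁ : ℕ) : ℝ :=
  maxAbsEntry X * √(t₁ : ℝ) / norm2 X

/-- `(v t₁ + n t₂) c²`. -/
def sizeParam {m n : ℕ} (X : Matrix (Fin m) (Fin n) ℝ) (v t₁ t₂ : ℕ) : ℝ :=
  ((v : ℝ) * t₁ + n * t₂) * maxAbsEntry X ^ 2

/-- `k = (v t₁ + n t₂) c² / ‖X‖₂²`. -/
def kParam {m n : ℕ} (X : Matrix (Fin m) (Fin n) ℝ) (v t₁ t₂ : ℕ) : ℝ :=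
  sizeParam X v t₁ t₂ / norm2 X ^ 2

/-- `φ = min((v t₁ + n t₂) c² / (100 n), t₁ c² / 100)`. -/
def phiParam {m n : ℕ} (X : Matrix (Fin m) (Fin n) ℝ) (v t₁ t₂ : ℕ) : ℝ :=
  min (1 / (100 * (n : ℝ)) * sizeParam X v t₁ t₂) (1 / 100 * t₁ * maxAbsEntry X ^ 2)

/-- The smallest admissible shift `11 (m u + (n+1) u) (v t₁ + n t₂) c²`. -/
def minShift {m n : ℕ} (X : Matrix (Fin m) (Fin n) ℝ) (v t₁ t₂ : ℕ) : ℝ :=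
  11 * (m * u + (n + 1) * u) * sizeParam X v t₁ t₂

/-! ### Floating-point computations

Computations follow the standard model of floating-point arithmetic: every elementary operation
(`+`, `-`, `*`, `/`, `√`) is carried out with a relative error of at most `u`, with no underflow
or overflow. The predicates below hold for every possible outcome of a computation. -/

/-- `z` is an admissible floating-point value of the exact result `x` of one operation. -/
def Rounded (x z : ℝ) : Prop := ∃ δ : ℝ, |δ| ≤ u ∧ z = x * (1 + δ)

/-- `FlSum f S z`: `z` is an admissible floating-point value of `∑ i ∈ S, f i`, the terms being
added in some order, with some placement of parentheses. -/
inductive FlSum {ι : Type} (f : ι → ℝ) : Finset ι → ℝ → Prop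
  | empty : FlSum f ∅ 0
  | single (i : ι) : FlSum f {i} (f i)
  | add {S T : Finset ι} {a b z : ℝ} (hST : Disjoint S T) (hS : S.Nonempty) (hT : T.Nonempty)
      (ha : FlSum f S a) (hb : FlSum f T b) (hz : Rounded (a + b) z) :
      FlSum f (S.disjUnion T hST) z

/-- `C` is an admissible floating-point value of the matrix product `A * B`. -/
def FlMul {m p n : ℕ} (A : Matrix (Fin m) (Fin p) ℝ) (B : Matrix (Fin p) (Fin n) ℝ)
    (C : Matrix (Fin m) (Fin n) ℝ) : Prop :=
  ∀ i j, ∃ q : Fin p → ℝ, (∀ k, Rounded (A i k * B k j) (q k)) ∧ FlSum q Finset.univ (C i j)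

/-- `A` is an admissible floating-point value of `G + s I`. -/
def FlShift {n : ℕ} (G : Matrix (Fin n) (Fin n) ℝ) (s : ℝ) (A : Matrix (Fin n) (Fin n) ℝ) : Prop :=
  ∀ i j, if i = j then Rounded (G i j + s) (A i j) else A i j = G i j

/-- `d` is an admissible floating-point value of `a - ∑ k < j, x k * y k`, with any order of
summation. -/
def FlSubDot {n : ℕ} (j : Fin n) (a : ℝ) (x y : Fin n → ℝ) (d : ℝ) : Prop :=
  ∃ q : Fin n → ℝ, (∀ k, k < j → Rounded (x k * y k) (q k)) ∧
    FlSum (fun k => if k = j then a else -q k) (Finset.Iic j) d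

/-- Row `i` of the upper triangular Cholesky factor `R` of `A` has been computed successfully from
the rows above it: the computed pivot `d` is positive, `r i i = √d`, and
`r i j = (a i j - ∑ k < i, r k i * r k j) / r i i` for `j > i`, up to rounding. -/
def FlCholeskyRow {n : ℕ} (A R : Matrix (Fin n) (Fin n) ℝ) (i : Fin n) : Prop :=
  (∃ d, FlSubDot i (A i i) (fun k => R k i) (fun k => R k i) d ∧ 0 < d ∧ Rounded √d (R i i)) ∧
  (∀ j, i < j → ∃ d, FlSubDot i (A i j) (fun k => R k i) (fun k => R k j) d ∧
    Rounded (d / R i i) (R i j)) ∧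
  (∀ j, j < i → R i j = 0)

/-- `R` is an admissible floating-point value of the Cholesky factor of `A`. -/
def FlCholesky {n : ℕ} (A R : Matrix (Fin n) (Fin n) ℝ) : Prop :=
  ∀ i, FlCholeskyRow A R i

/-- Some floating-point Cholesky factorization of `A` breaks down: after the successful computation
of the rows above row `i`, the computed pivot `d` is not positive. -/
def FlCholeskyBreaksDown {n : ℕ} (A : Matrix (Fin n) (Fin n) ℝ) : Prop :=
  ∃ (i : Fin n) (R : Matrix (Fin n) (Fin n) ℝ) (d : ℝ), (∀ k, k < i → FlCholeskyRow A R k) ∧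
    FlSubDot i (A i i) (fun k => R k i) (fun k => R k i) d ∧ d ≤ 0

/-- `W` is an admissible floating-point value of `X Y⁻¹` for upper triangular `Y`: each row `w` of
`W` is computed by substitution from the triangular system `w Y = x`, `x` the same row of `X`. -/
def FlTriSolve {m n : ℕ} (X : Matrix (Fin m) (Fin n) ℝ) (Y : Matrix (Fin n) (Fin n) ℝ)
    (W : Matrix (Fin m) (Fin n) ℝ) : Prop :=
  ∀ i j, ∃ d, FlSubDot j (X i j) (fun k => W i k) (fun k => Y k j) d ∧
    Rounded (d / Y j j) (W i j)

/-! ### The algorithms -/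

/-- `[Q, R] = CholeskyQR(X)` in floating-point arithmetic. -/
def CholeskyQR {m n : ℕ} (X Q : Matrix (Fin m) (Fin n) ℝ) (R : Matrix (Fin n) (Fin n) ℝ) : Prop :=
  ∃ G, FlMul X.transpose X G ∧ FlCholesky G R ∧ FlTriSolve X R Q

/-- Some floating-point execution of `CholeskyQR(X)` breaks down. -/
def CholeskyQRBreaksDown {m n : ℕ} (X : Matrix (Fin m) (Fin n) ℝ) : Prop :=
  ∃ G, FlMul X.transpose X G ∧ FlCholeskyBreaksDown G

/-- `[W, Y] = SCholeskyQR(X)` with shift `s` in floating-point arithmetic. -/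
def SCholeskyQR {m n : ℕ} (X : Matrix (Fin m) (Fin n) ℝ) (s : ℝ) (W : Matrix (Fin m) (Fin n) ℝ)
    (Y : Matrix (Fin n) (Fin n) ℝ) : Prop :=
  ∃ G A, FlMul X.transpose X G ∧ FlShift G s A ∧ FlCholesky A Y ∧ FlTriSolve X Y W

/-- Some floating-point execution of `SCholeskyQR(X)` with shift `s` breaks down. -/
def SCholeskyQRBreaksDown {m n : ℕ} (X : Matrix (Fin m) (Fin n) ℝ) (s : ℝ) : Prop :=
  ∃ G A, FlMul X.transpose X G ∧ FlShift G s A ∧ FlCholeskyBreaksDown A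

/-- Some floating-point execution of `CholeskyQR2(X)`, i.e. of `[V, D] = CholeskyQR(X)` followed by
`CholeskyQR(V)` and a product of triangular factors, breaks down. The product cannot fail. -/
def CholeskyQR2BreaksDown {m n : ℕ} (X : Matrix (Fin m) (Fin n) ℝ) : Prop :=
  CholeskyQRBreaksDown X ∨ ∃ V D, CholeskyQR X V D ∧ CholeskyQRBreaksDown V

/-- Some floating-point execution of `SCholeskyQR3(X)` with shift `s`, i.e. of
`[W, Y] = SCholeskyQR(X)` followed by `CholeskyQR2(W)` and a product of triangular factors,
breaks down. The product cannot fail. -/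
def SCholeskyQR3BreaksDown {m n : ℕ} (X : Matrix (Fin m) (Fin n) ℝ) (s : ℝ) : Prop :=
  SCholeskyQRBreaksDown X s ∨ ∃ W Y, SCholeskyQR X s W Y ∧ CholeskyQR2BreaksDown W

end SparseCholeskyQR

end

open SparseCholeskyQR

/-! Everything is measured by quadratic forms. A computed Gram matrix and its computed Cholesky
factor have entrywise backward errors of order `u` times the product of the square roots of two
diagonal entries of `XᵀX + sI`. By Cauchy–Schwarz the total perturbation of the quadratic form is at
most `cholErr` times the trace, with `cholErr` at most `1.25 (m + n + 1) u`
(`ApproxGram.sq_cholesky`, `cholErr_le`). For a `T₁` matrix the trace is at most `1.01 (v t₁ + n t₂)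
c²`, so the lower bound on `s` makes this at most `0.12 s`, a fraction of the form `‖Xy‖² + s‖y‖²`
itself.

Absence of breakdown is the delicate point, because a nonpositive pivot leaves no factor to which a
backward error bound applies. From the rows already computed and a rescaled pivot column, a singular
triangular matrix is built whose Gram matrix is still close to a positive definite form; a kernel
vector gives the contradiction (`ApproxGram.not_breaksDown`).

Substitution gives `WR = X - Δ`, where the Frobenius norm of `Δ` is bounded through that of `W`. The
assumption on `4n²u h l κ₂(X)` makes `Δ` small against `σ_min(X)`, and the dependence on `W` is
resolved by a bootstrap (`FlTriSolve.sq_mulVec_bounds`). The outcome is `‖Wz‖² ≤ 1.78‖z‖²` and `‖z‖²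
≤ 2(1 + s/σ_min(X)²)‖Wz‖²`, hence `κ₂(W)² ≤ 3.56(1 + α₀κ₂(X)²)`. Of `h` only `h² ≥ 2.23` is needed.

The same step with `s = 0` serves `CholeskyQR2`: the condition on `κ₂(W)` lets its first
factorization succeed, and the resulting `V` is so well conditioned that the second succeeds too. -/

namespace SparseCholeskyQR

/-! ### Rounding factors -/

theorem u_pos : 0 < u := by unfold u; positivity

theorem u_lt : u < 1 / 1000000000000000 := by unfold u; norm_num

/-- `t` is within the range of a product of `p` factors `(1 + δ)^{±1}` with `|δ| ≤ u`. -/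
def Near (p : ℕ) (t : ℝ) : Prop := (1 - u) ^ p ≤ t ∧ t ≤ ((1 - u) ^ p)⁻¹

theorem one_sub_u_pos : 0 < 1 - u := by linarith [u_lt]

theorem Near.pos {p : ℕ} {t : ℝ} (h : Near p t) : 0 < t :=
  (pow_pos one_sub_u_pos p).trans_le h.1

theorem Near.mul {p q : ℕ} {s t : ℝ} (hs : Near p s) (ht : Near q t) : Near (p + q) (s * t) := by
  have h1 := pow_pos one_sub_u_pos p
  have h2 := pow_pos one_sub_u_pos q
  refine ⟨?_, ?_⟩
  · rw [pow_add]; exact mul_le_mul hs.1 ht.1 h2.le hs.pos.le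
  · rw [pow_add, mul_inv]; exact mul_le_mul hs.2 ht.2 ht.pos.le (by positivity)

theorem Near.inv {p : ℕ} {t : ℝ} (h : Near p t) : Near p t⁻¹ :=
  ⟨by rw [← inv_inv ((1 - u) ^ p)]; exact inv_anti₀ h.pos h.2,
    inv_anti₀ (pow_pos one_sub_u_pos p) h.1⟩

theorem Near.mono {p q : ℕ} {t : ℝ} (h : Near p t) (hpq : p ≤ q) : Near q t := by
  have h1 : (1 - u) ^ q ≤ (1 - u) ^ p :=
    pow_le_pow_of_le_one one_sub_u_pos.le (by linarith [u_pos]) hpq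
  exact ⟨h1.trans h.1, h.2.trans (inv_anti₀ (pow_pos one_sub_u_pos q) h1)⟩

theorem near_one (p : ℕ) : Near p 1 := Near.mono (p := 0) (by simp [Near]) p.zero_le

theorem near_one_add {δ : ℝ} (h : |δ| ≤ u) : Near 1 (1 + δ) := by
  have := abs_le.1 h
  refine ⟨by linarith [pow_one (1 - u)], ?_⟩
  rw [pow_one, le_inv_comm₀ (by linarith [u_lt]) one_sub_u_pos]
  rw [inv_eq_one_div, le_div_iff₀ (by linarith [u_lt])]
  nlinarith [u_pos, mul_le_mul_of_nonneg_left this.2 one_sub_u_pos.le]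

theorem Rounded.exists_near {x z : ℝ} (h : Rounded x z) : ∃ t, Near 1 t ∧ z = x * t := by
  obtain ⟨δ, hδ, rfl⟩ := h
  exact ⟨_, near_one_add hδ, rfl⟩

/-- The bound on the relative error after `p` roundings. -/
noncomputable def gam (p : ℕ) : ℝ := ((1 - u) ^ p)⁻¹ - 1

theorem gam_mono {p q : ℕ} (h : p ≤ q) : gam p ≤ gam q := by
  have h1 : (1 - u) ^ q ≤ (1 - u) ^ p :=
    pow_le_pow_of_le_one one_sub_u_pos.le (by linarith [u_pos]) h
  exact sub_le_sub_right (inv_anti₀ (pow_pos one_sub_u_pos q) h1) 1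

theorem gam_nonneg (p : ℕ) : 0 ≤ gam p := by
  have := gam_mono p.zero_le
  simpa [gam] using this

/-- The upper deviation dominates: `1 - w ≤ w⁻¹ - 1` is equivalent to `(w - 1)² ≥ 0`. -/
theorem Near.abs_sub_one_le {p : ℕ} {t : ℝ} (h : Near p t) : |t - 1| ≤ gam p := by
  have hp := pow_pos one_sub_u_pos p
  set w := (1 - u) ^ p with hw
  have h2 : 2 - w ≤ w⁻¹ := by
    rw [inv_eq_one_div, le_div_iff₀ hp]
    nlinarith [sq_nonneg (w - 1)]
  rw [abs_le, gam, ← hw]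
  constructor <;> linarith [h.1, h.2]

theorem gam_le {p : ℕ} (h : (p : ℝ) * u ≤ 1 / 2000) : gam p ≤ 1.001 * (p * u) := by
  have h1 : 1 - p * u ≤ (1 - u) ^ p := by
    have := one_add_mul_le_pow (a := -u) (by linarith [u_lt]) p
    simpa [sub_eq_add_neg] using this
  have h0 : 0 ≤ (p : ℝ) * u := mul_nonneg p.cast_nonneg u_pos.le
  have h3 : ((1 - u) ^ p)⁻¹ ≤ (1 - p * u)⁻¹ := inv_anti₀ (by linarith) h1
  have h4 : (1 - p * u)⁻¹ ≤ 1 + 1.001 * (p * u) := by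
    rw [inv_eq_one_div, div_le_iff₀ (by linarith)]
    nlinarith
  unfold gam
  linarith

/-- In a binary tree of additions with `S.card` leaves, at most `S.card - 1` roundings lie between a
leaf and the root, whatever the order. -/
theorem FlSum.exists_near {ι : Type} {f : ι → ℝ} {S : Finset ι} {z : ℝ} (h : FlSum f S z) :
    ∃ t : ι → ℝ, (∀ k ∈ S, Near (S.card - 1) (t k)) ∧ z = ∑ k ∈ S, f k * t k := by
  classical
  induction h with
  | empty => exact ⟨fun _ => 1, by simp, by simp⟩
  | single i => exact ⟨fun _ => 1, fun _ _ => near_one _, by simp⟩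
  | @add S T a b z hST hS hT _ _ hz iha ihb =>
    obtain ⟨t, ht, rfl⟩ := iha
    obtain ⟨r, hr, rfl⟩ := ihb
    obtain ⟨e, he, rfl⟩ := hz.exists_near
    have hS' := hS.card_pos
    have hT' := hT.card_pos
    refine ⟨fun k => (if k ∈ S then t k else r k) * e, ?_, ?_⟩
    · intro k hk
      rw [Finset.card_disjUnion]
      rw [Finset.mem_disjUnion] at hk
      by_cases hkS : k ∈ S
      · simp only [hkS, if_true]
        exact ((ht k hkS).mul he).mono (by omega)
      · simp only [hkS, if_false]
        exact ((hr k (hk.resolve_left hkS)).mul he).mono (by omega)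
    · rw [Finset.sum_disjUnion, add_mul, Finset.sum_mul, Finset.sum_mul]
      congr 1
      · refine Finset.sum_congr rfl fun k hk => ?_
        simp only [hk, if_true]; ring
      · refine Finset.sum_congr rfl fun k hk => ?_
        simp only [Finset.disjoint_right.1 hST hk, if_false]; ring

/-- In a floating-point sum, the rounding factors can be normalized to leave one chosen
term unperturbed. -/
theorem FlSum.exists_near_at {ι : Type} {f : ι → ℝ} {S : Finset ι} {z : ℝ} (h : FlSum f S z) :
    ∀ a ∈ S, ∃ (P : ℝ) (t : ι → ℝ), Near (S.card - 1) P ∧ t a = 1 ∧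
      (∀ k ∈ S, Near (S.card - 1) (t k)) ∧ z = P * ∑ k ∈ S, f k * t k := by
  classical
  -- `P` collects the roundings on the path from the leaf `a` to the root. Dividing by `P` frees `a`
  -- of its factor and costs each term of the other summand `T` a factor `P⁻¹`; the last rounding
  -- `e` is common to all terms and goes into `P`.
  have key : ∀ (S T : Finset ι) (hST : Disjoint S T) (x y z : ℝ) (_ : S.Nonempty)
      (_ : T.Nonempty) (_ : FlSum f T y) (_ : Rounded (x + y) z) (a : ι) (_ : a ∈ S),
      (∃ (P : ℝ) (t : ι → ℝ), Near (S.card - 1) P ∧ t a = 1 ∧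
        (∀ k ∈ S, Near (S.card - 1) (t k)) ∧ x = P * ∑ k ∈ S, f k * t k) →
      ∃ (P : ℝ) (t : ι → ℝ), Near (S.card + T.card - 1) P ∧ t a = 1 ∧
        (∀ k, k ∈ S ∨ k ∈ T → Near (S.card + T.card - 1) (t k)) ∧
        z = P * (∑ k ∈ S, f k * t k + ∑ k ∈ T, f k * t k) := by
    rintro S T hST x y z hS hT hy hz a ha ⟨P, t, hP, hta, ht, rfl⟩
    obtain ⟨r, hr, rfl⟩ := hy.exists_near
    obtain ⟨e, he, rfl⟩ := hz.exists_near
    have hS' := hS.card_pos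
    have hT' := hT.card_pos
    refine ⟨P * e, fun k => if k ∈ S then t k else r k * P⁻¹, (hP.mul he).mono (by omega),
      by simp [ha, hta], ?_, ?_⟩
    · intro k hk
      by_cases hkS : k ∈ S
      · simp only [hkS, if_true]
        exact (ht k hkS).mono (by omega)
      · simp only [hkS, if_false]
        exact ((hr k (hk.resolve_left hkS)).mul hP.inv).mono (by omega)
    · have h1 : ∑ k ∈ S, f k * (if k ∈ S then t k else r k * P⁻¹) = ∑ k ∈ S, f k * t k :=
        Finset.sum_congr rfl fun k hk => by simp [hk]
      have h2 : ∑ k ∈ T, f k * (if k ∈ S then t k else r k * P⁻¹)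
          = (∑ k ∈ T, f k * r k) * P⁻¹ := by
        rw [Finset.sum_mul]
        refine Finset.sum_congr rfl fun k hk => ?_
        simp only [Finset.disjoint_right.1 hST hk, if_false]; ring
      rw [h1, h2]
      have := hP.pos.ne'
      field_simp
  induction h with
  | empty => simp
  | single i =>
    intro a ha
    rw [Finset.mem_singleton] at ha
    exact ⟨1, fun _ => 1, near_one _, rfl, fun _ _ => near_one _, by simp⟩
  | @add S T x y z hST hS hT hx hy hz ihx ihy =>
    intro a ha
    rw [Finset.mem_disjUnion] at ha
    simp only [Finset.card_disjUnion, Finset.sum_disjUnion, Finset.mem_disjUnion]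
    rcases ha with ha | ha
    · exact key S T hST x y z hS hT hy hz a ha (ihx a ha)
    · obtain ⟨P, t, hP, hta, ht, hz'⟩ :=
        key T S hST.symm y x z hT hS hx (by rwa [add_comm]) a ha (ihy a ha)
      refine ⟨P, t, by rwa [add_comm], hta, fun k hk => ?_, by rw [hz', add_comm]⟩
      rw [add_comm S.card]
      exact ht k hk.symm

/-- Normalizing at the index `j`, which carries `a`, leaves `a` exact, so that all errors can be
charged to the products and to the result. `Finset.Iic j` has `j + 1` terms, hence `j` additions; a
product has one more rounding. -/
theorem FlSubDot.exists_near {n : ℕ} {j : Fin n} {a d : ℝ} {x y : Fin n → ℝ}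
    (h : FlSubDot j a x y d) :
    ∃ (P : ℝ) (t : Fin n → ℝ), Near j P ∧ (∀ k < j, Near (j + 1) (t k)) ∧
      d = P * (a - ∑ k ∈ Finset.Iio j, x k * y k * t k) := by
  obtain ⟨q, hq, hd⟩ := h
  obtain ⟨P, t, hP, htj, ht, hd⟩ := hd.exists_near_at j (by simp)
  rw [Fin.card_Iic, Nat.add_sub_cancel] at hP ht
  choose! e he hqe using fun k hk => (hq k hk).exists_near
  refine ⟨P, fun k => e k * t k, hP, fun k hk => ?_, ?_⟩
  · rw [add_comm]
    exact (he k hk).mul (ht k (by simpa using hk.le))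
  · rw [hd, ← Finset.Iio_insert, Finset.sum_insert (by simp), sub_eq_add_neg,
      ← Finset.sum_neg_distrib]
    congr 2
    · simp [htj]
    · refine Finset.sum_congr rfl fun k hk => ?_
      have hk' : k < j := by simpa using hk
      simp only [hk'.ne, if_false, hqe k hk']
      ring

/-- Componentwise bound for a sum with perturbed terms. -/
theorem abs_sum_mul_sub_le {ι : Type*} (S : Finset ι) (f t : ι → ℝ) {p : ℕ}
    (ht : ∀ k ∈ S, Near p (t k)) :
    |∑ k ∈ S, f k * t k - ∑ k ∈ S, f k| ≤ gam p * ∑ k ∈ S, |f k| := by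
  rw [← Finset.sum_sub_distrib, Finset.mul_sum]
  refine (Finset.abs_sum_le_sum_abs _ _).trans (Finset.sum_le_sum fun k hk => ?_)
  rw [show f k * t k - f k = (t k - 1) * f k by ring, abs_mul]
  exact mul_le_mul_of_nonneg_right (ht k hk).abs_sub_one_le (abs_nonneg _)

/-- Backward error of one step of a substitution: `w * r + ∑ k < j, x k * y k` is close to `a`. -/
theorem FlSubDot.backward_error {n : ℕ} {j : Fin n} {a d r w : ℝ} {x y : Fin n → ℝ}
    (h : FlSubDot j a x y d) {p q : ℕ} {e : ℝ} (he : Near q e) (hw : w = d * e)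
    (hp : j + q ≤ p) (hp1 : j + 1 ≤ p) (hr : w = r) :
    |a - (r + ∑ k ∈ Finset.Iio j, x k * y k)|
      ≤ gam p * (|r| + ∑ k ∈ Finset.Iio j, |x k * y k|) := by
  subst hr
  obtain ⟨P, t, hP, ht, hd⟩ := h.exists_near
  have hPe := (hP.mul he).inv
  -- The computed relation is solved for the exact datum `a`.
  have ha : a = w * (P * e)⁻¹ + ∑ k ∈ Finset.Iio j, x k * y k * t k := by
    have h1 := hP.pos.ne'
    have h2 := he.pos.ne'
    rw [hw, hd]
    field_simp
    ring
  have h1 := abs_sum_mul_sub_le (Finset.Iio j) (fun k => x k * y k) t (p := p)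
    fun k hk => (ht k (by simpa using hk)).mono hp1
  have h2 : |w * (P * e)⁻¹ - w| ≤ gam p * |w| := by
    rw [show w * (P * e)⁻¹ - w = ((P * e)⁻¹ - 1) * w by ring, abs_mul]
    exact mul_le_mul_of_nonneg_right (hPe.mono hp).abs_sub_one_le (abs_nonneg _)
  rw [ha, show w * (P * e)⁻¹ + ∑ k ∈ Finset.Iio j, x k * y k * t k
    - (w + ∑ k ∈ Finset.Iio j, x k * y k) = (w * (P * e)⁻¹ - w) +
    (∑ k ∈ Finset.Iio j, x k * y k * t k - ∑ k ∈ Finset.Iio j, x k * y k) by ring, mul_add]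
  exact (abs_add_le _ _).trans (add_le_add h2 h1)

/-! ### Backward error of the matrix algorithms -/

theorem FlMul.backward_error {m p n : ℕ} {A : Matrix (Fin m) (Fin p) ℝ}
    {B : Matrix (Fin p) (Fin n) ℝ} {C : Matrix (Fin m) (Fin n) ℝ} (h : FlMul A B C)
    (i : Fin m) (j : Fin n) :
    ∃ t : Fin p → ℝ, (∀ k, Near p (t k)) ∧ C i j = ∑ k, A i k * B k j * t k := by
  obtain ⟨q, hq, hC⟩ := h i j
  obtain ⟨t, ht, hC⟩ := hC.exists_near
  choose e he hqe using fun k => (hq k).exists_near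
  refine ⟨fun k => e k * t k, fun k => ?_, ?_⟩
  · have := k.pos
    rw [Finset.card_univ, Fintype.card_fin] at ht
    exact ((he k).mul (ht k (Finset.mem_univ k))).mono (by omega)
  · rw [hC]
    exact Finset.sum_congr rfl fun k _ => by rw [hqe]; ring

theorem FlTriSolve.backward_error {m n : ℕ} {X W : Matrix (Fin m) (Fin n) ℝ}
    {Y : Matrix (Fin n) (Fin n) ℝ} (h : FlTriSolve X Y W) (hY : ∀ i, Y i i ≠ 0)
    (hY0 : ∀ i j, j < i → Y i j = 0) (i : Fin m) (j : Fin n) :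
    |X i j - ∑ k, W i k * Y k j| ≤ gam n * ∑ k, |W i k * Y k j| := by
  obtain ⟨d, hd, hW⟩ := h i j
  obtain ⟨e, he, hW⟩ := hW.exists_near
  have h1 := hd.backward_error (r := W i j * Y j j) (w := W i j * Y j j) (p := n) he
    (by rw [hW]; field_simp [hY j]) (by omega) (by omega) rfl
  have h2 : ∀ f : ℝ → ℝ, f 0 = 0 → ∑ k, f (W i k * Y k j)
      = f (W i j * Y j j) + ∑ k ∈ Finset.Iio j, f (W i k * Y k j) := by
    intro f hf
    rw [← Finset.sum_insert (f := fun k => f (W i k * Y k j)) (by simp : j ∉ Finset.Iio j),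
      Finset.Iio_insert]
    refine (Finset.sum_subset (Finset.subset_univ _) fun k _ hk => ?_).symm
    rw [hY0 k j (by simpa using hk), mul_zero, hf]
  rw [h2 (fun x => x) rfl, h2 (fun x => |x|) abs_zero]
  exact h1

theorem FlCholeskyRow.diag_pos {n : ℕ} {A R : Matrix (Fin n) (Fin n) ℝ} {i : Fin n}
    (h : FlCholeskyRow A R i) : 0 < R i i := by
  obtain ⟨⟨d, -, hd, hR⟩, -, -⟩ := h
  obtain ⟨e, he, hR⟩ := hR.exists_near
  rw [hR]
  exact mul_pos (Real.sqrt_pos.2 hd) he.pos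

theorem FlCholeskyRow.backward_error {n : ℕ} {A R : Matrix (Fin n) (Fin n) ℝ} {i j : Fin n}
    (h : FlCholeskyRow A R i) (hij : i ≤ j) :
    |A i j - ∑ k ∈ Finset.Iic i, R k i * R k j|
      ≤ gam (n + 1) * ∑ k ∈ Finset.Iic i, |R k i * R k j| := by
  have hpos := h.diag_pos
  rw [← Finset.Iio_insert, Finset.sum_insert (by simp), Finset.sum_insert (by simp)]
  rcases hij.eq_or_lt with rfl | hij
  · obtain ⟨⟨d, hd, hd0, hR⟩, -, -⟩ := h
    obtain ⟨e, he, hR⟩ := hR.exists_near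
    -- Squaring `R i i = √d * e` uses the rounding `e` twice; this is why the bound needs `gam (n +
    -- 1)` rather than `gam n`.
    refine hd.backward_error (he.mul he) (w := R i i * R i i) ?_ (by omega) (by omega) rfl
    rw [hR, mul_mul_mul_comm, Real.mul_self_sqrt hd0.le]
  · obtain ⟨d, hd, hR⟩ := h.2.1 j hij
    obtain ⟨e, he, hR⟩ := hR.exists_near
    refine hd.backward_error he (w := R i i * R i j) ?_ (by omega) (by omega) rfl
    rw [hR]
    field_simp

/-! ### Matrices and sums of squares -/

/-- The squared Euclidean norm. -/
noncomputable def sq {ι : Type*} [Fintype ι] (y : ι → ℝ) : ℝ := ∑ i, y i ^ 2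

theorem sq_fun_nonneg {ι : Type*} [Fintype ι] (y : ι → ℝ) : 0 ≤ sq y :=
  Finset.sum_nonneg fun _ _ => sq_nonneg _

theorem sq_eq_norm {ι : Type*} [Fintype ι] (y : ι → ℝ) : sq y = ‖WithLp.toLp 2 y‖ ^ 2 := by
  rw [EuclideanSpace.norm_sq_eq]
  simp [sq]

theorem sq_pos {ι : Type*} [Fintype ι] {y : ι → ℝ} (h : y ≠ 0) : 0 < sq y := by
  rw [sq_eq_norm]
  have : WithLp.toLp 2 y ≠ 0 := by simpa using h
  positivity

theorem sq_single {n : ℕ} (j : Fin n) : sq (Pi.single j (1 : ℝ)) = 1 := by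
  simp [sq, Pi.single_apply]

theorem sqrt_sq_add_le {ι : Type*} [Fintype ι] (x y : ι → ℝ) :
    √(sq (x + y)) ≤ √(sq x) + √(sq y) := by
  simp only [sq_eq_norm, Real.sqrt_sq (norm_nonneg _), WithLp.toLp_add]
  exact norm_add_le _ _

theorem sq_mulVec_le {m n : ℕ} (X : Matrix (Fin m) (Fin n) ℝ) (y : Fin n → ℝ) :
    sq (X.mulVec y) ≤ (∑ i, ∑ j, X i j ^ 2) * sq y := by
  unfold sq
  rw [Finset.sum_mul]
  exact Finset.sum_le_sum fun i _ => Finset.sum_mul_sq_le_sq_mul_sq Finset.univ (X i) y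

theorem toEuclideanLin_eq_toLp {m n : ℕ} (X : Matrix (Fin m) (Fin n) ℝ)
    (z : EuclideanSpace ℝ (Fin n)) :
    Matrix.toEuclideanLin X z = WithLp.toLp 2 (X.mulVec (WithLp.ofLp z)) := rfl

theorem finrank_range_toEuclideanLin {m n : ℕ} (X : Matrix (Fin m) (Fin n) ℝ) :
    Module.finrank ℝ (Matrix.toEuclideanLin X).range = X.rank := by
  rw [Matrix.rank_eq_finrank_range_toLin X (PiLp.basisFun 2 ℝ (Fin m)) (PiLp.basisFun 2 ℝ (Fin n)),
    ← Matrix.toLpLin_eq_toLin]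

/-! ### Operator norm and smallest singular value as bounds on quadratic forms. -/

theorem norm2_nonneg {m n : ℕ} (X : Matrix (Fin m) (Fin n) ℝ) : 0 ≤ norm2 X := norm_nonneg _

theorem sigmaMin_nonneg {m n : ℕ} (X : Matrix (Fin m) (Fin n) ℝ) : 0 ≤ sigmaMin X :=
  LinearMap.singularValues_nonneg _ _

theorem sq_mulVec_le_norm2 {m n : ℕ} (X : Matrix (Fin m) (Fin n) ℝ) (y : Fin n → ℝ) :
    sq (X.mulVec y) ≤ norm2 X ^ 2 * sq y := by
  have h := (Matrix.toEuclideanLin X).toContinuousLinearMap.le_opNorm (WithLp.toLp 2 y)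
  rw [LinearMap.coe_toContinuousLinearMap', toEuclideanLin_eq_toLp] at h
  rw [sq_eq_norm, sq_eq_norm, ← mul_pow]
  exact pow_le_pow_left₀ (norm_nonneg _) h 2

theorem norm2_sq_le {m n : ℕ} {X : Matrix (Fin m) (Fin n) ℝ} {c : ℝ} (hc : 0 ≤ c)
    (h : ∀ y, sq (X.mulVec y) ≤ c * sq y) : norm2 X ^ 2 ≤ c := by
  rw [← Real.sq_sqrt hc]
  refine pow_le_pow_left₀ (norm2_nonneg X) ?_ 2
  refine ContinuousLinearMap.opNorm_le_bound _ (Real.sqrt_nonneg _) fun y => ?_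
  refine le_of_sq_le_sq ?_ (by positivity)
  have := h (WithLp.ofLp y)
  rw [sq_eq_norm, sq_eq_norm] at this
  rw [mul_pow, Real.sq_sqrt hc]
  exact this

/-- In an eigenbasis of the adjoint composed with `T`, the form is a weighted sum of squared
coordinates. The eigenvalues decrease, so the one at index `n - 1` is the smallest weight. -/
theorem sigmaMin_sq_mul_le {m n : ℕ} (X : Matrix (Fin m) (Fin n) ℝ) (y : Fin n → ℝ) :
    sigmaMin X ^ 2 * sq y ≤ sq (X.mulVec y) := by
  set T := Matrix.toEuclideanLin X with hT
  have hn : Module.finrank ℝ (EuclideanSpace ℝ (Fin n)) = n := by simp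
  have hS := T.isSymmetric_adjoint_comp_self
  set b := hS.eigenvectorBasis hn
  set z : EuclideanSpace ℝ (Fin n) := WithLp.toLp 2 y with hz
  have h1 : sq (X.mulVec y) = ∑ i, hS.eigenvalues hn i * (inner ℝ (b i) z) ^ 2 := by
    have : sq (X.mulVec y) = inner ℝ z ((LinearMap.adjoint T ∘ₗ T) z) := by
      rw [LinearMap.comp_apply, LinearMap.adjoint_inner_right, real_inner_self_eq_norm_sq,
        sq_eq_norm, hT, hz, toEuclideanLin_eq_toLp]
    rw [this, ← b.sum_inner_mul_inner]
    refine Finset.sum_congr rfl fun i _ => ?_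
    rw [← hS, hS.apply_eigenvectorBasis, inner_smul_left, real_inner_comm]
    simp only [RCLike.ofReal_real_eq_id, id, conj_trivial]
    ring
  have h2 : sq y = ∑ i, (inner ℝ (b i) z) ^ 2 := by
    rw [sq_eq_norm, ← b.sum_sq_norm_inner_right]
    simp [hz]
  rw [h1, h2, Finset.mul_sum]
  refine Finset.sum_le_sum fun i _ => mul_le_mul_of_nonneg_right ?_ (sq_nonneg _)
  have hi := i.isLt
  have h3 := LinearMap.sq_singularValues_of_lt T hn (i := n - 1) (by omega)
  rw [sigmaMin, ← hT, h3]
  exact hS.eigenvalues_antitone hn (by rw [Fin.le_def]; simp only; omega)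

theorem le_sigmaMin_sq {m n : ℕ} {X : Matrix (Fin m) (Fin n) ℝ} {c : ℝ} (hn : 0 < n)
    (h : ∀ y, c * sq y ≤ sq (X.mulVec y)) : c ≤ sigmaMin X ^ 2 := by
  set T := Matrix.toEuclideanLin X with hT
  have hn' : Module.finrank ℝ (EuclideanSpace ℝ (Fin n)) = n := by simp
  obtain ⟨z, hz⟩ := (LinearMap.hasEigenvalue_adjoint_comp_self_sq_singularValues T (n := n - 1)
    (by omega)).exists_hasEigenvector
  have h1 := h (WithLp.ofLp z)
  have h2 : sq (X.mulVec (WithLp.ofLp z)) = inner ℝ z ((LinearMap.adjoint T ∘ₗ T) z) := by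
    rw [LinearMap.comp_apply, LinearMap.adjoint_inner_right, real_inner_self_eq_norm_sq,
      sq_eq_norm, hT, toEuclideanLin_eq_toLp]
  rw [h2, hz.apply_eq_smul, inner_smul_right, real_inner_self_eq_norm_sq, sq_eq_norm] at h1
  have h3 : 0 < ‖z‖ := norm_pos_iff.2 hz.2
  exact le_of_mul_le_mul_right h1 (by positivity)

theorem sigmaMin_pos {m n : ℕ} {X : Matrix (Fin m) (Fin n) ℝ} (hn : 0 < n) (h : X.rank = n) :
    0 < sigmaMin X := by
  rw [sigmaMin, LinearMap.singularValues_pos_iff_lt_finrank_range,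
    finrank_range_toEuclideanLin]
  omega

theorem rank_eq_of_sigmaMin_pos {m n : ℕ} {X : Matrix (Fin m) (Fin n) ℝ} (h : 0 < sigmaMin X) :
    X.rank = n := by
  refine le_antisymm (by simpa using X.rank_le_card_width) ?_
  rw [sigmaMin, LinearMap.singularValues_pos_iff_lt_finrank_range,
    finrank_range_toEuclideanLin] at h
  omega

theorem sum_sq_le_norm2 {m n : ℕ} (X : Matrix (Fin m) (Fin n) ℝ) :
    ∑ j, ∑ i, X i j ^ 2 ≤ n * norm2 X ^ 2 := by
  have : ∀ j, ∑ i, X i j ^ 2 ≤ norm2 X ^ 2 := fun j => by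
    have := sq_mulVec_le_norm2 X (Pi.single j 1)
    rw [sq_single, mul_one] at this
    simpa [sq] using this
  simpa using Finset.sum_le_sum fun j (_ : j ∈ Finset.univ) => this j

/-- Quadratic forms of matrices that are close entrywise. -/
theorem abs_quadForm_sub_le {n : ℕ} {M N : Fin n → Fin n → ℝ} {x y : Fin n → ℝ} {η : ℝ}
    (hη : 0 ≤ η)
    (h : ∀ j k, y j ≠ 0 → y k ≠ 0 → |M j k - N j k| ≤ η * (x j * x k)) :
    |∑ j, ∑ k, y j * y k * M j k - ∑ j, ∑ k, y j * y k * N j k| ≤ η * sq x * sq y := by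
  have h1 : |∑ j, ∑ k, y j * y k * M j k - ∑ j, ∑ k, y j * y k * N j k|
      ≤ ∑ j, ∑ k, η * ((x j * |y j|) * (x k * |y k|)) := by
    rw [← Finset.sum_sub_distrib]
    refine (Finset.abs_sum_le_sum_abs _ _).trans (Finset.sum_le_sum fun j _ => ?_)
    rw [← Finset.sum_sub_distrib]
    refine (Finset.abs_sum_le_sum_abs _ _).trans (Finset.sum_le_sum fun k _ => ?_)
    rw [← mul_sub, abs_mul, abs_mul]
    by_cases hj : y j = 0
    · simp [hj]
    by_cases hk : y k = 0
    · simp [hk]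
    calc |y j| * |y k| * |M j k - N j k| ≤ |y j| * |y k| * (η * (x j * x k)) :=
          mul_le_mul_of_nonneg_left (h j k hj hk) (by positivity)
      _ = _ := by ring
  refine h1.trans ?_
  have h2 : ∑ j, ∑ k, η * ((x j * |y j|) * (x k * |y k|)) = η * (∑ j, x j * |y j|) ^ 2 := by
    rw [pow_two, Finset.sum_mul_sum, Finset.mul_sum]
    exact Finset.sum_congr rfl fun j _ => by rw [Finset.mul_sum]
  rw [h2, mul_assoc]
  refine mul_le_mul_of_nonneg_left ?_ hη
  have := Finset.sum_mul_sq_le_sq_mul_sq Finset.univ x fun j => |y j|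
  simpa [sq] using this

theorem sq_mulVec_eq {m n : ℕ} (X : Matrix (Fin m) (Fin n) ℝ) (y : Fin n → ℝ) :
    sq (X.mulVec y) = ∑ j, ∑ k, y j * y k * ∑ i, X i j * X i k := by
  have : ∀ i, X.mulVec y i ^ 2 = ∑ j, ∑ k, y j * y k * (X i j * X i k) := fun i => by
    rw [Matrix.mulVec, dotProduct, pow_two, Finset.sum_mul_sum]
    exact Finset.sum_congr rfl fun j _ => Finset.sum_congr rfl fun k _ => by ring
  simp only [sq, this, Finset.mul_sum]
  rw [Finset.sum_comm]
  exact Finset.sum_congr rfl fun j _ => Finset.sum_comm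

/-! ### Cholesky factorization of a computed Gram matrix -/

/-- The exact shifted Gram matrix `XᵀX + s I`. -/
noncomputable def gram {m n : ℕ} (X : Matrix (Fin m) (Fin n) ℝ) (s : ℝ) (i j : Fin n) : ℝ :=
  ∑ k, X k i * X k j + if i = j then s else 0

theorem gram_comm {m n : ℕ} (X : Matrix (Fin m) (Fin n) ℝ) (s : ℝ) (i j : Fin n) :
    gram X s i j = gram X s j i := by
  unfold gram
  simp only [mul_comm, eq_comm]

theorem gram_quadForm {m n : ℕ} (X : Matrix (Fin m) (Fin n) ℝ) (s : ℝ) (y : Fin n → ℝ) :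
    ∑ j, ∑ k, y j * y k * gram X s j k = sq (X.mulVec y) + s * sq y := by
  simp only [gram, mul_add, Finset.sum_add_distrib, sq_mulVec_eq]
  congr 1
  simp only [mul_ite, mul_zero, Finset.sum_ite_eq, Finset.mem_univ, if_true, sq, Finset.mul_sum]
  exact Finset.sum_congr rfl fun j _ => by ring

/-- The square roots of the diagonal entries of the shifted Gram matrix. -/
noncomputable def colScale {m n : ℕ} (X : Matrix (Fin m) (Fin n) ℝ) (s : ℝ) (j : Fin n) : ℝ :=
  √(∑ k, X k j ^ 2 + s)

theorem colScale_nonneg {m n : ℕ} (X : Matrix (Fin m) (Fin n) ℝ) (s : ℝ) (j : Fin n) :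
    0 ≤ colScale X s j := Real.sqrt_nonneg _

theorem colScale_sq {m n : ℕ} (X : Matrix (Fin m) (Fin n) ℝ) {s : ℝ} (hs : 0 ≤ s) (j : Fin n) :
    colScale X s j ^ 2 = ∑ k, X k j ^ 2 + s :=
  Real.sq_sqrt (add_nonneg (Finset.sum_nonneg fun _ _ => sq_nonneg _) hs)

theorem gram_self {m n : ℕ} (X : Matrix (Fin m) (Fin n) ℝ) {s : ℝ} (hs : 0 ≤ s) (j : Fin n) :
    gram X s j j = colScale X s j ^ 2 := by
  rw [colScale_sq X hs, gram, if_pos rfl]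
  simp only [pow_two]

theorem sum_abs_mul_le {ι : Type*} (S : Finset ι) (f g : ι → ℝ) :
    ∑ k ∈ S, |f k * g k| ≤ √(∑ k ∈ S, f k ^ 2) * √(∑ k ∈ S, g k ^ 2) := by
  have := Real.sum_mul_le_sqrt_mul_sqrt S (fun k => |f k|) (fun k => |g k|)
  simpa [abs_mul] using this

/-- `A` is close to `XᵀX + s I`, as a computed Gram matrix is. -/
def ApproxGram {m n : ℕ} (X : Matrix (Fin m) (Fin n) ℝ) (s : ℝ)
    (A : Matrix (Fin n) (Fin n) ℝ) : Prop :=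
  ∀ i j, |A i j - gram X s i j| ≤ gam (m + 1) * (colScale X s i * colScale X s j)

/-- Each rounding error is relative to one term of an entry. On the diagonal the terms add up to
`colScale X s i ^ 2`; off the diagonal Cauchy–Schwarz applies. -/
theorem ApproxGram.of_near {m n : ℕ} {X : Matrix (Fin m) (Fin n) ℝ} {s : ℝ} (hs : 0 ≤ s)
    {A : Matrix (Fin n) (Fin n) ℝ}
    (h : ∀ i j, ∃ (t : Fin m → ℝ) (e : ℝ), (∀ k, Near (m + 1) (t k)) ∧ Near (m + 1) e ∧
      A i j = ∑ k, X k i * X k j * t k + (if i = j then s else 0) * e) : ApproxGram X s A := by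
  intro i j
  obtain ⟨t, e, ht, he, hA⟩ := h i j
  have h1 := abs_sum_mul_sub_le Finset.univ (fun k => X k i * X k j) t fun k _ => ht k
  have hg := gam_nonneg (m + 1)
  have h2 : ∑ k, |X k i * X k j| + (if i = j then s else 0) ≤ colScale X s i * colScale X s j := by
    split_ifs with hij
    · subst hij
      rw [← pow_two, colScale_sq X hs]
      simp [pow_two]
    · rw [add_zero]
      refine (sum_abs_mul_le _ _ _).trans (mul_le_mul ?_ ?_ (Real.sqrt_nonneg _)
        (Real.sqrt_nonneg _)) <;> exact Real.sqrt_le_sqrt (by linarith)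
  have h3 : |(if i = j then s else 0) * e - (if i = j then s else 0)|
      ≤ gam (m + 1) * (if i = j then s else 0) := by
    set w := if i = j then s else 0
    have hw : 0 ≤ w := by simp only [w]; split_ifs <;> simp [hs]
    rw [show w * e - w = (e - 1) * w by ring, abs_mul, abs_of_nonneg hw]
    exact mul_le_mul_of_nonneg_right he.abs_sub_one_le hw
  rw [hA, gram, add_sub_add_comm]
  refine (abs_add_le _ _).trans ((add_le_add h1 h3).trans ?_)
  rw [← mul_add]
  exact mul_le_mul_of_nonneg_left h2 hg

theorem approxGram_of_flMul {m n : ℕ} {X : Matrix (Fin m) (Fin n) ℝ}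
    {G : Matrix (Fin n) (Fin n) ℝ} (h : FlMul X.transpose X G) : ApproxGram X 0 G := by
  refine .of_near le_rfl fun i j => ?_
  obtain ⟨t, ht, hG⟩ := h.backward_error i j
  exact ⟨t, 1, fun k => (ht k).mono (by omega), near_one _, by rw [hG]; simp⟩

theorem approxGram_of_flShift {m n : ℕ} {X : Matrix (Fin m) (Fin n) ℝ} {s : ℝ} (hs : 0 ≤ s)
    {G A : Matrix (Fin n) (Fin n) ℝ} (h : FlMul X.transpose X G) (hA : FlShift G s A) :
    ApproxGram X s A := by
  refine .of_near hs fun i j => ?_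
  obtain ⟨t, ht, hG⟩ := h.backward_error i j
  have hA := hA i j
  split_ifs at hA with hij
  · obtain ⟨e, he, hA⟩ := hA.exists_near
    refine ⟨fun k => t k * e, e, fun k => (ht k).mul he, he.mono (by omega), ?_⟩
    rw [hA, hG, add_mul, Finset.sum_mul, if_pos hij]
    congr 1
    exact Finset.sum_congr rfl fun k _ => by simp only [Matrix.transpose_apply]; ring
  · exact ⟨t, 1, fun k => (ht k).mono (by omega), near_one _, by
      rw [hA, hG, if_neg hij]; simp⟩

/-- The columns of a computed Cholesky factor are hardly longer than expected. -/
theorem ApproxGram.col_le {m n : ℕ} {X : Matrix (Fin m) (Fin n) ℝ} {s : ℝ}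
    {A R : Matrix (Fin n) (Fin n) ℝ} (h : ApproxGram X s A) (hs : 0 ≤ s)
    (ha : gam (m + 1) ≤ 1 / 1000) (hg : gam (n + 1) ≤ 1 / 1000) {j : Fin n}
    (hR : FlCholeskyRow A R j) :
    √(∑ k ∈ Finset.Iic j, R k j ^ 2) ≤ 1.002 * colScale X s j := by
  have h1 := hR.backward_error le_rfl
  have h2 := h j j
  rw [gram_self X hs, ← pow_two] at h2
  simp only [← pow_two, abs_pow, sq_abs] at h1
  have hx := colScale_nonneg X s j
  have h4 : 0 ≤ ∑ k ∈ Finset.Iic j, R k j ^ 2 := Finset.sum_nonneg fun _ _ => sq_nonneg _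
  refine Real.sqrt_le_iff.2 ⟨by positivity, ?_⟩
  set S := ∑ k ∈ Finset.Iic j, R k j ^ 2
  set x := colScale X s j ^ 2
  have hx2 : 0 ≤ x := sq_nonneg _
  have h5 := (abs_le.1 h1).1
  have h6 := (abs_le.1 h2).2
  have h7 : gam (n + 1) * S ≤ 1 / 1000 * S := mul_le_mul_of_nonneg_right hg h4
  have h8 : gam (m + 1) * x ≤ 1 / 1000 * x := mul_le_mul_of_nonneg_right ha hx2
  rw [mul_pow]
  change S ≤ 1.002 ^ 2 * x
  linarith

/-- The relative size of the total perturbation of a Gram matrix by rounding in its computation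
and Cholesky factorization. -/
noncomputable def cholErr (m n : ℕ) : ℝ := gam (m + 1) + 1.01 * gam (n + 1)

theorem cholErr_nonneg (m n : ℕ) : 0 ≤ cholErr m n := by
  have := gam_nonneg (m + 1)
  have := gam_nonneg (n + 1)
  unfold cholErr; linarith

/-- The backward error of the factorization is relative to the inner product of the absolute columns
of `R`, which `ApproxGram.col_le` bounds. The factor `1.01` in `cholErr` covers `1.002²`. -/
theorem ApproxGram.entry_le {m n : ℕ} {X : Matrix (Fin m) (Fin n) ℝ} {s : ℝ}
    {A R : Matrix (Fin n) (Fin n) ℝ} (h : ApproxGram X s A) (hs : 0 ≤ s)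
    (ha : gam (m + 1) ≤ 1 / 1000) (hg : gam (n + 1) ≤ 1 / 1000) {i j : Fin n} (hij : i ≤ j)
    (hi : FlCholeskyRow A R i) (hj : FlCholeskyRow A R j) :
    |∑ k ∈ Finset.Iic i, R k i * R k j - gram X s i j|
      ≤ cholErr m n * (colScale X s i * colScale X s j) := by
  have h1 := hi.backward_error hij
  have h2 := h i j
  have hxi := colScale_nonneg X s i
  have hxj := colScale_nonneg X s j
  have h3 : √(∑ k ∈ Finset.Iic i, R k j ^ 2) ≤ √(∑ k ∈ Finset.Iic j, R k j ^ 2) :=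
    Real.sqrt_le_sqrt (Finset.sum_le_sum_of_subset_of_nonneg (Finset.Iic_subset_Iic.2 hij)
      fun _ _ _ => sq_nonneg _)
  have h4 : ∑ k ∈ Finset.Iic i, |R k i * R k j|
      ≤ (1.002 * colScale X s i) * (1.002 * colScale X s j) :=
    (sum_abs_mul_le _ _ _).trans (mul_le_mul (h.col_le hs ha hg hi)
      (h3.trans (h.col_le hs ha hg hj)) (Real.sqrt_nonneg _) (by positivity))
  have h5 := mul_le_mul_of_nonneg_left h4 (gam_nonneg (n + 1))
  have h6 : 0 ≤ gam (n + 1) * (colScale X s i * colScale X s j) :=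
    mul_nonneg (gam_nonneg _) (by positivity)
  rw [abs_sub_comm] at h1
  refine (abs_sub_le _ (A i j) _).trans ((add_le_add (h1.trans h5) h2).trans ?_)
  unfold cholErr
  linarith

/-- The computed Cholesky factor of a computed Gram matrix reproduces its quadratic form. -/
theorem ApproxGram.sq_cholesky {m n : ℕ} {X : Matrix (Fin m) (Fin n) ℝ} {s : ℝ}
    {A R : Matrix (Fin n) (Fin n) ℝ} (h : ApproxGram X s A) (hs : 0 ≤ s)
    (ha : gam (m + 1) ≤ 1 / 1000) (hg : gam (n + 1) ≤ 1 / 1000) (hR : FlCholesky A R)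
    (y : Fin n → ℝ) :
    |sq (R.mulVec y) - (sq (X.mulVec y) + s * sq y)|
      ≤ cholErr m n * sq (colScale X s) * sq y := by
  rw [← gram_quadForm, sq_mulVec_eq]
  refine abs_quadForm_sub_le (cholErr_nonneg m n) fun i j _ _ => ?_
  have key : ∀ i j : Fin n, i ≤ j → |∑ k, R k i * R k j - gram X s i j|
      ≤ cholErr m n * (colScale X s i * colScale X s j) := by
    intro i j hij
    have := h.entry_le hs ha hg hij (hR i) (hR j)
    rwa [Finset.sum_subset (Finset.subset_univ (Finset.Iic i)) fun k _ hk => by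
      rw [(hR k).2.2 i (by simpa using hk), zero_mul]] at this
  rcases le_total i j with hij | hij
  · exact key i j hij
  · have := key j i hij
    simpa only [mul_comm, gram_comm X s i j] using this

theorem exists_mulVec_eq_zero_of_diag_eq_zero {n : ℕ} {Z : Matrix (Fin n) (Fin n) ℝ} {i : Fin n}
    (h : ∀ k j, j < k → Z k j = 0) (hi : Z i i = 0) : ∃ y ≠ 0, Z.mulVec y = 0 := by
  rw [Matrix.exists_mulVec_eq_zero_iff, Matrix.det_of_isUpperTriangular fun k j hkj => h k j hkj]
  exact Finset.prod_eq_zero (Finset.mem_univ i) hi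

set_option maxHeartbeats 1000000 in
/-- The Cholesky factorization of a computed Gram matrix does not break down if rounding cannot
destroy positive definiteness. -/
theorem ApproxGram.not_breaksDown {m n : ℕ} {X : Matrix (Fin m) (Fin n) ℝ} {s μ : ℝ}
    {A : Matrix (Fin n) (Fin n) ℝ} (h : ApproxGram X s A) (hs : 0 ≤ s)
    (ha : gam (m + 1) ≤ 1 / 1000) (hg : gam (n + 1) ≤ 1 / 1000) (hμ : 0 < μ)
    (hX : ∀ y, μ * sq y ≤ sq (X.mulVec y) + s * sq y)
    (hη : cholErr m n * sq (colScale X s) < μ) : ¬ FlCholeskyBreaksDown A := by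
  rintro ⟨i, R, d, hR, hd, hd0⟩
  obtain ⟨P, t, hP, ht, hd⟩ := hd.exists_near
  set a := gam (m + 1)
  set g := gam (n + 1)
  have ha0 : 0 ≤ a := gam_nonneg _
  have hg0 : 0 ≤ g := gam_nonneg _
  set x := colScale X s
  have hx : ∀ j, 0 ≤ x j := colScale_nonneg X s
  have hxi : 0 < x i ^ 2 := by
    have h1 := hX (Pi.single i 1)
    rw [← gram_quadForm, sq_single] at h1
    simp only [Pi.single_apply, ite_mul, one_mul, zero_mul, mul_ite, mul_one, mul_zero,
      Finset.sum_ite_eq', Finset.mem_univ, if_true] at h1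
    rw [gram_self X hs] at h1
    linarith
  have hAi := h i i
  rw [gram_self X hs, ← pow_two] at hAi
  have hA1 : A i i ≤ (1 + a) * x i ^ 2 := by linarith [(abs_le.1 hAi).2]
  have hA2 : (1 - a) * x i ^ 2 ≤ A i i := by linarith [(abs_le.1 hAi).1]
  have hApos : 0 < A i i := lt_of_lt_of_le (mul_pos (by linarith) hxi) hA2
  set S := ∑ k ∈ Finset.Iio i, R k i ^ 2 with hS
  -- A nonpositive pivot means that the perturbed sum of squares above it already reaches `A i i`.
  have hAS : A i i ≤ (1 + g) * S := by
    have h1 : A i i ≤ ∑ k ∈ Finset.Iio i, R k i * R k i * t k := by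
      by_contra! hlt
      have := mul_pos hP.pos (sub_pos.2 hlt)
      linarith
    refine h1.trans ?_
    rw [hS, Finset.mul_sum]
    refine Finset.sum_le_sum fun k hk => ?_
    have h2 := (abs_le.1 ((ht k (by simpa using hk)).mono
      (show (i : ℕ) + 1 ≤ n + 1 by omega)).abs_sub_one_le).2
    rw [← pow_two, mul_comm]
    exact mul_le_mul_of_nonneg_right (by linarith) (sq_nonneg _)
  have hSpos : 0 < S := by
    by_contra! hle
    nlinarith
  -- Column `i` has no completed pivot, so `S` has no upper bound. Scaling the column by `τ ≤ 1`
  -- brings its squared length to `A i i / (1 + g)`.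
  set τ := √(A i i / ((1 + g) * S)) with hτ
  have hτ0 : 0 ≤ τ := Real.sqrt_nonneg _
  have hτ1 : τ ≤ 1 := Real.sqrt_le_one.2 ((div_le_one (by positivity)).2 hAS)
  have hτS : τ ^ 2 * S * (1 + g) = A i i := by
    rw [hτ, Real.sq_sqrt (by positivity)]
    field_simp
  -- The factor that would result from pivot zero: rows of `R` above `i`, column `i` scaled by `τ`,
  -- a zero at `(i, i)`, and an identity block beyond, which forces kernel vectors to vanish there.
  let Z : Matrix (Fin n) (Fin n) ℝ := fun k j =>
    if k < i then (if j < i then R k j else if j = i then τ * R k i else 0)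
    else if k = j ∧ k ≠ i then 1 else 0
  obtain ⟨y, hy0, hy⟩ := exists_mulVec_eq_zero_of_diag_eq_zero (Z := Z) (i := i) (fun k j hjk => by
    by_cases hk : k < i
    · simp [Z, hk, hjk.trans hk, (hR k hk).2.2 j hjk]
    · simp [Z, hk, hjk.ne']) (by simp [Z])
  have hyi : ∀ j, y j ≠ 0 → j ≤ i := by
    intro j hj
    by_contra! hij
    have h1 := congrFun hy j
    have h2 : ∀ k, Z j k = if j = k then 1 else 0 := fun k => by
      simp [Z, hij.not_gt, hij.ne']
    simp only [Matrix.mulVec, dotProduct, h2, ite_mul, one_mul, zero_mul, Finset.sum_ite_eq,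
      Finset.mem_univ, if_true, Pi.zero_apply] at h1
    exact hj h1
  -- The Gram matrix that `Z` approximates: the scaling by `τ` acts on row and column `i` but spares
  -- the diagonal entry.
  let N : Fin n → Fin n → ℝ := fun j k =>
    if (j = i ↔ k = i) then gram X s j k else τ * gram X s j k
  -- Damping the off-diagonal entries of row and column `i` is a convex combination of the original
  -- form and the form with the sign of `y i` flipped, so the lower bound `μ` survives.
  have hN : ∑ j, ∑ k, y j * y k * N j k
      = (1 + τ) / 2 * (sq (X.mulVec y) + s * sq y) + (1 - τ) / 2 *
        (sq (X.mulVec fun j => if j = i then -y j else y j) +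
          s * sq fun j => if j = i then -y j else y j) := by
    rw [← gram_quadForm, ← gram_quadForm]
    simp only [Finset.mul_sum, ← Finset.sum_add_distrib]
    refine Finset.sum_congr rfl fun j _ => Finset.sum_congr rfl fun k _ => ?_
    by_cases hj : j = i <;> by_cases hk : k = i <;> simp only [N, hj, hk, if_true, if_false,
      iff_true, iff_false, not_true] <;> ring
  have hflip : (sq fun j => if j = i then -y j else y j) = sq y := by
    refine Finset.sum_congr rfl fun j _ => ?_
    dsimp only
    split_ifs <;> ring
  have hNμ : μ * sq y ≤ ∑ j, ∑ k, y j * y k * N j k := by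
    have h1 := hX y
    have h2 := hX fun j => if j = i then -y j else y j
    rw [hN]
    rw [hflip] at h2 ⊢
    nlinarith [mul_le_mul_of_nonneg_left h1 (by linarith : 0 ≤ (1 + τ) / 2),
      mul_le_mul_of_nonneg_left h2 (by linarith : 0 ≤ (1 - τ) / 2)]
  have hZlt : ∀ j k, j < i → ∑ l, Z l j * Z l k = ∑ l ∈ Finset.Iic j, R l j *
      (if k < i then R l k else if k = i then τ * R l i else 0) := by
    intro j k hj
    symm
    rw [← Finset.sum_subset (Finset.subset_univ (Finset.Iic j)) fun l _ hl => ?_]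
    · refine Finset.sum_congr rfl fun l hl => ?_
      have hl : l < i := (Finset.mem_Iic.1 hl).trans_lt hj
      simp [Z, hl, hj]
    · have hl : j < l := by simpa using hl
      by_cases hli : l < i
      · simp [Z, hli, hj, (hR l hli).2.2 j hl]
      · simp [Z, hli, hl.ne']
  have hentry : ∀ j k, j ≤ k → k ≤ i → |∑ l, Z l j * Z l k - N j k|
      ≤ cholErr m n * (x j * x k) := by
    intro j k hjk hki
    rcases hki.eq_or_lt with rfl | hki
    · rcases hjk.eq_or_lt with rfl | hjk
      · have h1 : ∑ l, Z l j * Z l j = τ ^ 2 * S := by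
          rw [hS, Finset.mul_sum,
            ← Finset.sum_subset (Finset.subset_univ (Finset.Iio j)) fun l _ hl => ?_]
          · refine Finset.sum_congr rfl fun l hl => ?_
            have hl : l < j := by simpa using hl
            simp only [Z, hl, if_true, lt_irrefl, if_false]
            ring
          · have hl : ¬ l < j := by simpa using hl
            simp only [Z, hl, if_false]
            split_ifs with h2
            · exact absurd h2.1 h2.2
            · simp
        have h2 : N j j = x j ^ 2 := by simp only [N, if_true]; exact gram_self X hs j
        have h3 : 0 ≤ τ ^ 2 * S := by positivity
        rw [h1, h2, ← pow_two, abs_le]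
        have h4 : g * (τ ^ 2 * S) ≤ g * (1.001 * x j ^ 2) := by
          refine mul_le_mul_of_nonneg_left ?_ hg0
          have : τ ^ 2 * S ≤ A j j := by nlinarith
          nlinarith
        have h5 : cholErr m n * x j ^ 2 = a * x j ^ 2 + 1.01 * g * x j ^ 2 := by
          unfold cholErr; ring
        have h6 : 0 ≤ g * x j ^ 2 := by positivity
        have h7 : 0 ≤ g * (τ ^ 2 * S) := by positivity
        rw [h5]
        constructor <;> linarith
      · have h1 : ∑ l, Z l j * Z l k = τ * ∑ l ∈ Finset.Iic j, R l j * R l k := by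
          rw [hZlt j k hjk, Finset.mul_sum]
          refine Finset.sum_congr rfl fun l _ => ?_
          simp only [lt_irrefl, if_false, if_true]
          ring
        have h2 : N j k = τ * gram X s j k := by simp [N, hjk.ne]
        have h3 := (hR j hjk).backward_error hjk.le
        rw [abs_sub_comm] at h3
        have h4 := h j k
        -- The scaled column obeys nearly the bound of a completed one; `1.002 * 1.005 < 1.01` then
        -- fits into `cholErr`.
        have h5 : τ * √S ≤ 1.005 * x k := by
          rw [← Real.sqrt_sq hτ0, ← Real.sqrt_mul (sq_nonneg τ)]
          refine Real.sqrt_le_iff.2 ⟨by linarith [hx k], ?_⟩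
          have : τ ^ 2 * S ≤ A k k := by
            have : 0 ≤ g * (τ ^ 2 * S) := by positivity
            linarith
          nlinarith
        have h6 : √(∑ l ∈ Finset.Iic j, R l k ^ 2) ≤ √S :=
          Real.sqrt_le_sqrt (Finset.sum_le_sum_of_subset_of_nonneg (fun l hl => by
            simp only [Finset.mem_Iic, Finset.mem_Iio] at hl ⊢
            exact hl.trans_lt hjk) fun _ _ _ => sq_nonneg _)
        have h7 := h.col_le hs ha hg (hR j hjk)
        have h8 : τ * ∑ l ∈ Finset.Iic j, |R l j * R l k| ≤ 1.002 * x j * (1.005 * x k) := by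
          calc τ * ∑ l ∈ Finset.Iic j, |R l j * R l k|
              ≤ τ * ((1.002 * x j) * √S) := by
                refine mul_le_mul_of_nonneg_left ((sum_abs_mul_le _ _ _).trans ?_) hτ0
                exact mul_le_mul h7 h6 (Real.sqrt_nonneg _) (by linarith [hx j])
            _ = 1.002 * x j * (τ * √S) := by ring
            _ ≤ _ := mul_le_mul_of_nonneg_left h5 (by linarith [hx j])
        have h9 : 0 ≤ x j * x k := mul_nonneg (hx j) (hx k)
        rw [h1, h2, ← mul_sub, abs_mul, abs_of_nonneg hτ0]
        calc τ * |∑ l ∈ Finset.Iic j, R l j * R l k - gram X s j k|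
            ≤ τ * (g * ∑ l ∈ Finset.Iic j, |R l j * R l k| + a * (x j * x k)) :=
              mul_le_mul_of_nonneg_left ((abs_sub_le _ (A j k) _).trans (add_le_add h3 h4)) hτ0
          _ = g * (τ * ∑ l ∈ Finset.Iic j, |R l j * R l k|) + τ * (a * (x j * x k)) := by ring
          _ ≤ g * (1.002 * x j * (1.005 * x k)) + 1 * (a * (x j * x k)) :=
              add_le_add (mul_le_mul_of_nonneg_left h8 hg0)
                (mul_le_mul_of_nonneg_right hτ1 (mul_nonneg ha0 h9))
          _ ≤ cholErr m n * (x j * x k) := by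
              have : 0 ≤ g * (x j * x k) := mul_nonneg hg0 h9
              have h5 : cholErr m n * (x j * x k) = a * (x j * x k) + 1.01 * (g * (x j * x k)) := by
                unfold cholErr; ring
              rw [h5]
              linarith
    · have hji := hjk.trans_lt hki
      have h1 : N j k = gram X s j k := by simp [N, hji.ne, hki.ne]
      rw [hZlt j k hji, h1]
      simp only [hki, if_true]
      exact h.entry_le hs ha hg hjk (hR j hji) (hR k hki)
  -- Only entries on the support of `y` are compared, so columns beyond `i` play no role. Since `Zy
  -- = 0`, the form `N` at `y` is at most `cholErr` times the trace times `sq y`, below `μ * sq y`.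
  have hfin := abs_quadForm_sub_le (M := fun j k => ∑ l, Z l j * Z l k) (N := N) (x := x) (y := y)
    (cholErr_nonneg m n) fun j k hj hk => by
      rcases le_total j k with hjk | hjk
      · exact hentry j k hjk (hyi k hk)
      · have h1 := hentry k j hjk (hyi j hj)
        have h2 : N k j = N j k := by
          simp only [N, gram_comm X s j k]
          congr 1
          exact propext iff_comm
        rw [h2, mul_comm (x k)] at h1
        convert h1 using 3
        exact Finset.sum_congr rfl fun l _ => mul_comm _ _
  rw [← sq_mulVec_eq, hy] at hfin
  have h0 : sq (0 : Fin n → ℝ) = 0 := by simp [sq]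
  rw [h0] at hfin
  have hy2 := sq_pos hy0
  have h1 := (abs_le.1 hfin).1
  nlinarith

/-! ### One step of (shifted) CholeskyQR -/

theorem sum_sq_eq_sum_sq_mulVec_single {m n : ℕ} (W : Matrix (Fin m) (Fin n) ℝ) :
    ∑ i, ∑ j, W i j ^ 2 = ∑ j, sq (W.mulVec (Pi.single j 1)) := by
  rw [Finset.sum_comm]
  simp [sq]

/-- The matrix `W` computed by substitution from `W R = X` is nearly as well conditioned as the
exact one if `R` approximates the Cholesky factor of `XᵀX + s I`. -/
theorem FlTriSolve.sq_mulVec_bounds {m n : ℕ} {X W : Matrix (Fin m) (Fin n) ℝ}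
    {R : Matrix (Fin n) (Fin n) ℝ} {s a F : ℝ} (hW : FlTriSolve X R W)
    (hR : ∀ i, R i i ≠ 0) (hR0 : ∀ i j, j < i → R i j = 0) (hs : 0 ≤ s) (ha : 0 < a)
    (hX : ∀ y, a * sq y ≤ sq (X.mulVec y))
    (hq : ∀ y, |sq (R.mulVec y) - (sq (X.mulVec y) + s * sq y)|
      ≤ 0.12 * (sq (X.mulVec y) + s * sq y))
    (hF : ∑ j, ∑ k, R k j ^ 2 ≤ F) (hτ : gam n ^ 2 * n * F ≤ 0.175 ^ 2 * a) (z : Fin n → ℝ) :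
    sq (W.mulVec z) ≤ 1.78 * sq z ∧ sq z ≤ 2 * (1 + s / a) * sq (W.mulVec z) := by
  set Δ := X - W * R with hΔ
  set D := ∑ i, ∑ j, Δ i j ^ 2
  have hD0 : 0 ≤ D := Finset.sum_nonneg fun _ _ => Finset.sum_nonneg fun _ _ => sq_nonneg _
  set E := ∑ i, ∑ j, W i j ^ 2 with hE
  have hE0 : 0 ≤ E := Finset.sum_nonneg fun _ _ => Finset.sum_nonneg fun _ _ => sq_nonneg _
  have hDE : D ≤ gam n ^ 2 * E * F := by
    have h1 : ∀ i j, Δ i j ^ 2 ≤ gam n ^ 2 * ((∑ k, W i k ^ 2) * ∑ k, R k j ^ 2) := by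
      intro i j
      have h2 := hW.backward_error hR hR0 i j
      have h3 := sum_abs_mul_le Finset.univ (W i) (fun k => R k j)
      have h4 : |Δ i j| ≤ gam n * (√(∑ k, W i k ^ 2) * √(∑ k, R k j ^ 2)) :=
        h2.trans (mul_le_mul_of_nonneg_left h3 (gam_nonneg n))
      have h5 := pow_le_pow_left₀ (abs_nonneg _) h4 2
      rwa [sq_abs, mul_pow, mul_pow, Real.sq_sqrt (Finset.sum_nonneg fun _ _ => sq_nonneg _),
        Real.sq_sqrt (Finset.sum_nonneg fun _ _ => sq_nonneg _)] at h5
    calc D ≤ ∑ i, ∑ j, gam n ^ 2 * ((∑ k, W i k ^ 2) * ∑ k, R k j ^ 2) :=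
          Finset.sum_le_sum fun i _ => Finset.sum_le_sum fun j _ => h1 i j
      _ = gam n ^ 2 * E * ∑ j, ∑ k, R k j ^ 2 := by
          rw [hE, mul_assoc, Finset.sum_mul_sum, Finset.mul_sum]
          exact Finset.sum_congr rfl fun i _ => by rw [Finset.mul_sum]
      _ ≤ _ := mul_le_mul_of_nonneg_left hF (by positivity)
  have hsurj : ∀ z, ∃ y, R.mulVec y = z := by
    have : IsUnit R := by
      rw [Matrix.isUnit_iff_isUnit_det, Matrix.det_of_isUpperTriangular fun k j hkj => hR0 k j hkj]
      exact (Finset.prod_ne_zero_iff.2 fun i _ => hR i).isUnit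
    exact Matrix.mulVec_surjective_iff_isUnit.2 this
  -- `D` is the squared Frobenius norm of `Δ` and `a` bounds `XᵀX` below, so `‖Δy‖ ≤ δ‖Xy‖`: the
  -- error is relative to `Xy`.
  set δ := √(D / a)
  have hδ0 : 0 ≤ δ := Real.sqrt_nonneg _
  have hδ : δ ^ 2 * a = D := by
    rw [Real.sq_sqrt (by positivity)]; field_simp
  have hWX : ∀ y, W.mulVec (R.mulVec y) = X.mulVec y + -(Δ.mulVec y) := fun y => by
    rw [hΔ, Matrix.sub_mulVec, Matrix.mulVec_mulVec]; abel
  have hneg : ∀ w : Fin m → ℝ, sq (-w) = sq w := fun w => by simp [sq]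
  have hΔy : ∀ y, √(sq (Δ.mulVec y)) ≤ δ * √(sq (X.mulVec y)) := by
    intro y
    rw [← Real.sqrt_sq hδ0, ← Real.sqrt_mul (sq_nonneg δ)]
    refine Real.sqrt_le_sqrt ((sq_mulVec_le Δ y).trans ?_)
    change D * sq y ≤ _
    rw [← hδ, mul_assoc]
    exact mul_le_mul_of_nonneg_left (hX y) (sq_nonneg δ)
  have hup : ∀ y, √(sq (W.mulVec (R.mulVec y))) ≤ (1 + δ) * √(sq (X.mulVec y)) := by
    intro y
    have := sqrt_sq_add_le (X.mulVec y) (-(Δ.mulVec y))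
    rw [← hWX, hneg] at this
    linarith [hΔy y]
  have hlo : ∀ y, (1 - δ) * √(sq (X.mulVec y)) ≤ √(sq (W.mulVec (R.mulVec y))) := by
    intro y
    have := sqrt_sq_add_le (W.mulVec (R.mulVec y)) (Δ.mulVec y)
    rw [show W.mulVec (R.mulVec y) + Δ.mulVec y = X.mulVec y by rw [hWX]; abel] at this
    linarith [hΔy y]
  have hXR : ∀ y, 0.88 * sq (X.mulVec y) ≤ sq (R.mulVec y) := by
    intro y
    have h1 := (abs_le.1 (hq y)).1
    have h2 := mul_nonneg hs (sq_fun_nonneg y)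
    linarith
  have hup' : ∀ z, sq (W.mulVec z) ≤ (1 + δ) ^ 2 / 0.88 * sq z := by
    intro z
    obtain ⟨y, rfl⟩ := hsurj z
    have h1 := pow_le_pow_left₀ (Real.sqrt_nonneg _) (hup y) 2
    rw [mul_pow, Real.sq_sqrt (sq_fun_nonneg _), Real.sq_sqrt (sq_fun_nonneg _)] at h1
    rw [div_mul_eq_mul_div, le_div_iff₀ (by norm_num)]
    have h2 := mul_le_mul_of_nonneg_left (hXR y) (sq_nonneg (1 + δ))
    linarith
  have hEn : E ≤ n * ((1 + δ) ^ 2 / 0.88) := by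
    rw [hE, sum_sq_eq_sum_sq_mulVec_single]
    have := Finset.sum_le_sum fun j (_ : j ∈ Finset.univ) => hup' (Pi.single j (1 : ℝ))
    simpa only [sq_single, mul_one, Finset.sum_const, Finset.card_univ, Fintype.card_fin,
      nsmul_eq_mul] using this
  -- Bootstrap: `D` is bounded by `E`, and `E` by `n (1 + δ)² / 0.88`. This gives `δ ≤ 0.19 (1 +
  -- δ)`, as `0.175² / 0.88 < 0.19²`.
  have hδ4 : δ ≤ 1 / 4 := by
    have hF0 : 0 ≤ F :=
      (Finset.sum_nonneg fun _ _ => Finset.sum_nonneg fun _ _ => sq_nonneg _).trans hF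
    have h1 : D ≤ 0.175 ^ 2 * a * ((1 + δ) ^ 2 / 0.88) := by
      calc D ≤ gam n ^ 2 * F * E := by linarith
        _ ≤ gam n ^ 2 * F * (n * ((1 + δ) ^ 2 / 0.88)) :=
            mul_le_mul_of_nonneg_left hEn (by positivity)
        _ = gam n ^ 2 * n * F * ((1 + δ) ^ 2 / 0.88) := by ring
        _ ≤ _ := mul_le_mul_of_nonneg_right hτ (by positivity)
    have h2 : δ ^ 2 ≤ (0.19 * (1 + δ)) ^ 2 := by
      have : δ ^ 2 * a ≤ (0.19 * (1 + δ)) ^ 2 * a := by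
        rw [hδ]
        refine h1.trans ?_
        have : 0 ≤ a * (1 + δ) ^ 2 := by positivity
        rw [mul_pow, show 0.175 ^ 2 * a * ((1 + δ) ^ 2 / 0.88)
          = 0.175 ^ 2 / 0.88 * (a * (1 + δ) ^ 2) by ring,
          show 0.19 ^ 2 * (1 + δ) ^ 2 * a = 0.19 ^ 2 * (a * (1 + δ) ^ 2) by ring]
        exact mul_le_mul_of_nonneg_right (by norm_num) this
      exact le_of_mul_le_mul_right this ha
    have h3 := le_of_sq_le_sq h2 (by positivity)
    linarith
  constructor
  · refine (hup' z).trans (mul_le_mul_of_nonneg_right ?_ (sq_fun_nonneg z))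
    rw [div_le_iff₀ (by norm_num)]
    nlinarith
  -- The constant `2` exceeds `1.12 / 0.75²`, with `0.75 ≤ 1 - δ`.
  · obtain ⟨y, rfl⟩ := hsurj z
    have h1 := pow_le_pow_left₀ (mul_nonneg (by linarith) (Real.sqrt_nonneg _)) (hlo y) 2
    rw [mul_pow, Real.sq_sqrt (sq_fun_nonneg _), Real.sq_sqrt (sq_fun_nonneg _)] at h1
    have h2 : 0.5625 * sq (X.mulVec y) ≤ sq (W.mulVec (R.mulVec y)) := by
      refine le_trans (mul_le_mul_of_nonneg_right ?_ (sq_fun_nonneg _)) h1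
      nlinarith
    have h3 : s * sq y ≤ s / a * sq (X.mulVec y) := by
      rw [div_mul_eq_mul_div, le_div_iff₀ ha, mul_assoc]
      exact mul_le_mul_of_nonneg_left (by linarith [hX y]) hs
    have h4 := (abs_le.1 (hq y)).2
    have h5 : 0 ≤ 1 + s / a := by positivity
    have h6 := mul_le_mul_of_nonneg_left h2 h5
    have h7 := mul_nonneg h5 (sq_fun_nonneg (X.mulVec y))
    nlinarith

/-- `(m + n + 1) u` bounds all the rounding errors. -/
noncomputable def unitErr (m n : ℕ) : ℝ := m * u + (n + 1) * u

theorem unitErr_eq (m n : ℕ) : unitErr m n = (m + n + 1) * u := by unfold unitErr; ring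

theorem gam_le_unitErr {m n : ℕ} (h : unitErr m n ≤ 1 / 2000) {p : ℕ} (hp : p ≤ m + n + 1) :
    gam p ≤ 1.001 * (p * u) ∧ gam p ≤ 1 / 1000 := by
  have h0 : (p : ℝ) ≤ m + n + 1 := by exact_mod_cast hp
  have h1 : (p : ℝ) * u ≤ unitErr m n := by
    rw [unitErr_eq]
    exact mul_le_mul_of_nonneg_right h0 u_pos.le
  have h2 := gam_le (h1.trans h)
  exact ⟨h2, by linarith⟩

/-- The counts `m + 1` and `n + 1` exceed `m + n + 1` by one in total; `m, n ≥ 2` lets the factor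
`1.25` absorb it. -/
theorem cholErr_le {m n : ℕ} (h : unitErr m n ≤ 1 / 2000) (hm : 2 ≤ m) (hn : 2 ≤ n) :
    cholErr m n ≤ 1.25 * unitErr m n := by
  have h1 := (gam_le_unitErr h (p := m + 1) (by omega)).1
  have h2 := (gam_le_unitErr h (p := n + 1) (by omega)).1
  have hm' : (2 : ℝ) ≤ m := by exact_mod_cast hm
  have hn' : (2 : ℝ) ≤ n := by exact_mod_cast hn
  have h3 := mul_le_mul_of_nonneg_right hm' u_pos.le
  have h4 := mul_le_mul_of_nonneg_right hn' u_pos.le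
  push_cast at h1 h2
  rw [unitErr_eq, cholErr]
  linarith [u_pos]

/-- One step of (shifted) CholeskyQR with `μ I ≤ XᵀX + s I` and `a I ≤ XᵀX`. -/
theorem ApproxGram.choleskyQR_step {m n : ℕ} {X : Matrix (Fin m) (Fin n) ℝ} {s μ a : ℝ}
    {A : Matrix (Fin n) (Fin n) ℝ} (h : ApproxGram X s A) (hε : unitErr m n ≤ 1 / 2000)
    (hm : 2 ≤ m) (hn : 2 ≤ n) (hs : 0 ≤ s) (hμ : 0 < μ) (ha : 0 < a)
    (hXμ : ∀ y, μ * sq y ≤ sq (X.mulVec y) + s * sq y) (hXa : ∀ y, a * sq y ≤ sq (X.mulVec y))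
    (hT : 1.25 * unitErr m n * sq (colScale X s) ≤ 0.12 * μ)
    (hF : (n * u) ^ 2 * n * sq (colScale X s) ≤ 0.0289 * a) :
    ¬ FlCholeskyBreaksDown A ∧ ∀ R W, FlCholesky A R → FlTriSolve X R W → ∀ z,
      sq (W.mulVec z) ≤ 1.78 * sq z ∧ sq z ≤ 2 * (1 + s / a) * sq (W.mulVec z) := by
  have h1 := (gam_le_unitErr hε (p := m + 1) (by omega)).2
  have h2 := (gam_le_unitErr hε (p := n + 1) (by omega)).2
  have h3 := (gam_le_unitErr hε (p := n) (by omega)).1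
  have hx0 := sq_fun_nonneg (colScale X s)
  have h4 : cholErr m n * sq (colScale X s) ≤ 0.12 * μ :=
    (mul_le_mul_of_nonneg_right (cholErr_le hε hm hn) hx0).trans hT
  refine ⟨h.not_breaksDown hs h1 h2 hμ hXμ (by linarith), fun R W hR hW => ?_⟩
  have hR0 : ∀ i j, j < i → R i j = 0 := fun i => (hR i).2.2
  -- `F` uses `1.002² < 1.005`; the last condition uses `1.001² * 1.005 * 0.0289 < 0.175²`.
  refine hW.sq_mulVec_bounds (fun i => (hR i).diag_pos.ne') hR0 hs ha hXa
    (F := 1.005 * sq (colScale X s)) (fun y => ?_) ?_ ?_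
  · refine (h.sq_cholesky hs h1 h2 hR y).trans ?_
    have := mul_le_mul_of_nonneg_right h4 (sq_fun_nonneg y)
    linarith [hXμ y]
  · rw [sq, Finset.mul_sum]
    refine Finset.sum_le_sum fun j _ => ?_
    have h5 := h.col_le hs h1 h2 (hR j)
    have h6 := pow_le_pow_left₀ (Real.sqrt_nonneg _) h5 2
    rw [Real.sq_sqrt (Finset.sum_nonneg fun _ _ => sq_nonneg _), mul_pow,
      Finset.sum_subset (Finset.subset_univ (Finset.Iic j)) fun k _ hk => by
        rw [hR0 k j (by simpa using hk)]; ring] at h6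
    linarith [sq_nonneg (colScale X s j)]
  · have h5 := pow_le_pow_left₀ (gam_nonneg n) h3 2
    have h6 : 0 ≤ (n : ℝ) * sq (colScale X s) := by positivity
    have h7 := mul_le_mul_of_nonneg_right h5 h6
    nlinarith

theorem sq_colScale {m n : ℕ} (X : Matrix (Fin m) (Fin n) ℝ) {s : ℝ} (hs : 0 ≤ s) :
    sq (colScale X s) = ∑ j, (∑ k, X k j ^ 2 + s) :=
  Finset.sum_congr rfl fun j _ => colScale_sq X hs j

/-- `CholeskyQR` of a sufficiently well conditioned matrix succeeds. -/
theorem choleskyQR_of_sq_mulVec_bounds {m n : ℕ} {X : Matrix (Fin m) (Fin n) ℝ} {a b : ℝ}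
    (hε : n * unitErr m n ≤ 1 / 1100) (hm : 2 ≤ m) (hn : 2 ≤ n) (ha : 0 < a)
    (hXa : ∀ y, a * sq y ≤ sq (X.mulVec y)) (hXb : ∀ y, sq (X.mulVec y) ≤ b * sq y)
    (hab : 64 * (n * unitErr m n) * b ≤ a) :
    ¬ CholeskyQRBreaksDown X ∧ ∀ Q R, CholeskyQR X Q R → ∀ z,
      sq (Q.mulVec z) ≤ 1.78 * sq z ∧ sq z ≤ 2 * sq (Q.mulVec z) := by
  have hn' : (2 : ℝ) ≤ n := by exact_mod_cast hn
  have hε0 : 0 ≤ unitErr m n := by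
    rw [unitErr_eq]; exact mul_nonneg (by positivity) u_pos.le
  have hε1 : unitErr m n ≤ 1 / 2000 := by nlinarith
  have hcol : ∀ j, ∑ k, X k j ^ 2 ≤ b := fun j => by
    have := hXb (Pi.single j 1)
    rw [sq_single, mul_one] at this
    simpa [sq] using this
  have hb : 0 ≤ b :=
    (Finset.sum_nonneg fun _ _ => sq_nonneg _).trans (hcol ⟨0, by omega⟩)
  have hx : sq (colScale X 0) ≤ n * b := by
    rw [sq_colScale X le_rfl]
    simpa using Finset.sum_le_sum fun j (_ : j ∈ Finset.univ) => hcol j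
  have hT : 1.25 * unitErr m n * sq (colScale X 0) ≤ 0.12 * a := by
    have := mul_le_mul_of_nonneg_left hx hε0
    linarith
  have hF : (n * u) ^ 2 * n * sq (colScale X 0) ≤ 0.0289 * a := by
    have h1 : (n : ℝ) ^ 2 * u ≤ n * unitErr m n := by
      rw [unitErr_eq, pow_two, mul_assoc]
      refine mul_le_mul_of_nonneg_left (mul_le_mul_of_nonneg_right ?_ u_pos.le) (by positivity)
      linarith [(Nat.cast_nonneg m : (0 : ℝ) ≤ m)]
    have h0 : 0 ≤ (n : ℝ) ^ 2 * u := mul_nonneg (by positivity) u_pos.le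
    have h2 : (n : ℝ) ^ 2 * u * b ≤ a / 64 := by
      have := mul_le_mul_of_nonneg_right h1 hb
      linarith
    have h3 := mul_le_mul (h1.trans hε) h2 (mul_nonneg h0 hb) (by norm_num)
    have h4 : ((n : ℝ) * u) ^ 2 * n * sq (colScale X 0) ≤ (n * u) ^ 2 * n * (n * b) :=
      mul_le_mul_of_nonneg_left hx (by positivity)
    calc _ ≤ _ := h4
      _ = n ^ 2 * u * (n ^ 2 * u * b) := by ring
      _ ≤ _ := h3
      _ ≤ _ := by linarith
  have key : ∀ G, FlMul X.transpose X G → _ := fun G hG =>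
    (approxGram_of_flMul hG).choleskyQR_step hε1 hm hn le_rfl ha ha
      (fun y => by simpa using hXa y) hXa hT hF
  refine ⟨fun ⟨G, hG, hbd⟩ => (key G hG).1 hbd, fun Q R ⟨G, hG, hR, hQ⟩ z => ?_⟩
  simpa using (key G hG).2 R Q hR hQ z

/-- `CholeskyQR2` of a sufficiently well conditioned matrix does not break down. -/
theorem not_choleskyQR2BreaksDown {m n : ℕ} {X : Matrix (Fin m) (Fin n) ℝ} {a b : ℝ}
    (hε : n * unitErr m n ≤ 1 / 1100) (hm : 2 ≤ m) (hn : 2 ≤ n) (ha : 0 < a)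
    (hXa : ∀ y, a * sq y ≤ sq (X.mulVec y)) (hXb : ∀ y, sq (X.mulVec y) ≤ b * sq y)
    (hab : 64 * (n * unitErr m n) * b ≤ a) : ¬ CholeskyQR2BreaksDown X := by
  obtain ⟨h1, h2⟩ := choleskyQR_of_sq_mulVec_bounds hε hm hn ha hXa hXb hab
  rintro (h | ⟨V, D, hV, h⟩)
  · exact h1 h
  · have h3 := h2 V D hV
    -- The bounds on `V` no longer depend on `X`, and `64 * 1.78 / 1100 < 1 / 2`.
    exact (choleskyQR_of_sq_mulVec_bounds hε hm hn (a := 1 / 2) (b := 1.78) (by norm_num)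
      (fun y => by linarith [(h3 y).2]) (fun y => (h3 y).1) (by linarith)).1 h

/-! ### `T₁` matrices -/

theorem abs_le_maxAbsEntry {m n : ℕ} (X : Matrix (Fin m) (Fin n) ℝ) (i : Fin m) (j : Fin n) :
    |X i j| ≤ maxAbsEntry X :=
  le_ciSup (f := fun p : Fin m × Fin n => |X p.1 p.2|) (Set.finite_range _).bddAbove (i, j)

theorem sum_sq_le_ncard {m n : ℕ} (X : Matrix (Fin m) (Fin n) ℝ) (j : Fin n) {t : ℕ}
    (h : {i | X i j ≠ 0}.ncard ≤ t) : ∑ i, X i j ^ 2 ≤ t * maxAbsEntry X ^ 2 := by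
  classical
  have h1 : ∑ i, X i j ^ 2 = ∑ i with X i j ≠ 0, X i j ^ 2 := by
    rw [Finset.sum_filter]
    refine Finset.sum_congr rfl fun i _ => ?_
    split_ifs with h
    · rfl
    · rw [not_not.1 h]; ring
  have h2 : (Finset.univ.filter fun i => X i j ≠ 0).card ≤ t := by
    rw [← Set.ncard_coe_finset]
    simpa using h
  rw [h1]
  refine (Finset.sum_le_card_nsmul _ _ (maxAbsEntry X ^ 2) fun i _ => ?_).trans ?_
  · rw [← sq_abs]
    exact pow_le_pow_left₀ (abs_nonneg _) (abs_le_maxAbsEntry X i j) 2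
  · rw [nsmul_eq_mul]
    exact mul_le_mul_of_nonneg_right (by exact_mod_cast h2) (sq_nonneg _)

theorem IsT1Matrix.col_le {m n v t₁ t₂ : ℕ} {X : Matrix (Fin m) (Fin n) ℝ}
    (h : IsT1Matrix X v t₁ t₂) (j : Fin n) : ∑ i, X i j ^ 2 ≤ t₁ * maxAbsEntry X ^ 2 := by
  obtain ⟨D, -, hD, hD'⟩ := h.columns
  by_cases hj : j ∈ D
  · exact sum_sq_le_ncard X j (hD j hj)
  · exact sum_sq_le_ncard X j ((hD' j hj).trans h.t₂_lt.le)

/-- Charging `t₂` to every column, the dense ones included, gives `n t₂` in place of `(n - v) t₂`.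
-/
theorem IsT1Matrix.sum_sq_le {m n v t₁ t₂ : ℕ} {X : Matrix (Fin m) (Fin n) ℝ}
    (h : IsT1Matrix X v t₁ t₂) : ∑ j, ∑ i, X i j ^ 2 ≤ sizeParam X v t₁ t₂ := by
  classical
  obtain ⟨D, hv, hD, hD'⟩ := h.columns
  have h1 : ∑ j, ∑ i, X i j ^ 2 ≤ ∑ j, ((if j ∈ D then t₁ * maxAbsEntry X ^ 2 else 0)
      + t₂ * maxAbsEntry X ^ 2) := by
    refine Finset.sum_le_sum fun j _ => ?_
    split_ifs with hj
    · have := sum_sq_le_ncard X j (hD j hj)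
      have : 0 ≤ t₂ * maxAbsEntry X ^ 2 := by positivity
      linarith
    · rw [zero_add]
      exact sum_sq_le_ncard X j (hD' j hj)
  refine h1.trans_eq ?_
  rw [Finset.sum_add_distrib]
  simp [hv, sizeParam]
  ring

/-! ### Parameters, condition numbers and the shifted step. -/

theorem hParam_sq {m n v : ℕ} : 2.23 ≤ hParam m n v ^ 2 := by
  have hr : 0 ≤ rParam m n v := by unfold rParam; positivity
  rw [hParam, Real.sq_sqrt (by positivity)]
  have : 0 ≤ rParam m n v ^ 2 := sq_nonneg _
  linarith

theorem hParam_pos {m n v : ℕ} : 0 < hParam m n v := by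
  have hr : 0 ≤ rParam m n v := by unfold rParam; positivity
  exact Real.sqrt_pos.2 (by positivity)

theorem cond2_nonneg {m n : ℕ} (X : Matrix (Fin m) (Fin n) ℝ) : 0 ≤ cond2 X :=
  div_nonneg (norm2_nonneg X) (sigmaMin_nonneg X)

theorem cond2_sq_le {m n : ℕ} {W : Matrix (Fin m) (Fin n) ℝ} {b e : ℝ} (hn : 0 < n) (hb : 0 ≤ b)
    (he : 0 < e) (h : ∀ z, sq (W.mulVec z) ≤ b * sq z ∧ sq z ≤ e * sq (W.mulVec z)) :
    0 < sigmaMin W ∧ cond2 W ^ 2 ≤ b * e := by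
  have h1 := norm2_sq_le hb fun z => (h z).1
  have h2 : e⁻¹ ≤ sigmaMin W ^ 2 := le_sigmaMin_sq hn fun z => by
    rw [inv_mul_le_iff₀ he]; exact (h z).2
  have h3 : 0 < sigmaMin W ^ 2 := (inv_pos.2 he).trans_le h2
  have h4 : 0 < sigmaMin W :=
    (sigmaMin_nonneg W).lt_of_ne fun h0 => by simp [← h0] at h3
  refine ⟨h4, ?_⟩
  rw [cond2, div_pow, div_le_iff₀ h3]
  have h5 : 1 ≤ e * sigmaMin W ^ 2 := by
    have := mul_le_mul_of_nonneg_left h2 he.le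
    rwa [mul_inv_cancel₀ he.ne'] at this
  nlinarith

/-- Facts about the shift that follow from the assumptions on it. -/
theorem IsT1Matrix.shift_facts {m n v t₁ t₂ : ℕ} {X : Matrix (Fin m) (Fin n) ℝ} {s : ℝ}
    (hX : IsT1Matrix X v t₁ t₂) (hrank : X.rank = n)
    (hs : minShift X v t₁ t₂ ≤ s ∧ s ≤ phiParam X v t₁ t₂) :
    2 ≤ n ∧ 2 ≤ m ∧ 0 < norm2 X ∧ 0 < sigmaMin X ∧ 0 < sizeParam X v t₁ t₂ ∧ 0 < s ∧
      n * unitErr m n ≤ 1 / 1100 ∧ 11 * unitErr m n * sizeParam X v t₁ t₂ ≤ s ∧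
      n * s ≤ 1 / 100 * sizeParam X v t₁ t₂ ∧ s ≤ 1 / 100 * t₁ * maxAbsEntry X ^ 2 := by
  have hn : 2 ≤ n := by have := hX.v_pos; have := hX.v_lt; omega
  have hm : 2 ≤ m := by
    have := X.rank_le_card_height
    rw [hrank, Fintype.card_fin] at this
    omega
  have hn' : (2 : ℝ) ≤ n := by exact_mod_cast hn
  have hσ := sigmaMin_pos (by omega) hrank
  have hsz : 0 < ∑ i, ∑ j, X i j ^ 2 := by
    have h1 := sigmaMin_sq_mul_le X (Pi.single ⟨0, by omega⟩ 1)
    have h2 := sq_mulVec_le X (Pi.single ⟨0, by omega⟩ 1)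
    rw [sq_single, mul_one] at h1 h2
    exact (by positivity : 0 < sigmaMin X ^ 2).trans_le (h1.trans h2)
  have hN : 0 < norm2 X := by
    refine (norm2_nonneg X).lt_of_ne fun h0 => ?_
    have := sum_sq_le_norm2 X
    rw [← h0, Finset.sum_comm] at this
    simp only [ne_eq, OfNat.ofNat_ne_zero, not_false_eq_true, zero_pow, mul_zero] at this
    linarith
  have hS : 0 < sizeParam X v t₁ t₂ := by
    refine hsz.trans_le ?_
    rw [Finset.sum_comm]
    exact hX.sum_sq_le
  have hε0 : 0 < unitErr m n := by
    rw [unitErr_eq]; exact mul_pos (by positivity) u_pos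
  have h11 : 11 * unitErr m n * sizeParam X v t₁ t₂ ≤ s := hs.1
  have h1 : s ≤ 1 / (100 * (n : ℝ)) * sizeParam X v t₁ t₂ := hs.2.trans (min_le_left _ _)
  have h2 : s ≤ 1 / 100 * t₁ * maxAbsEntry X ^ 2 := hs.2.trans (min_le_right _ _)
  have h3 : n * s ≤ 1 / 100 * sizeParam X v t₁ t₂ := by
    have := mul_le_mul_of_nonneg_left h1 (by linarith : (0 : ℝ) ≤ n)
    refine this.trans_eq ?_
    field_simp
  refine ⟨hn, hm, hN, hσ, hS, lt_of_lt_of_le (by positivity) h11, ?_, h11, h3, h2⟩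
  -- The two bounds on `s` are compatible only if `11 n (m + n + 1) u ≤ 1 / 100`, so the smallness
  -- of the unit roundoff against the dimensions is implied.
  have h4 := (mul_le_mul_of_nonneg_left h11 (by linarith : (0 : ℝ) ≤ n)).trans h3
  have h5 : (11 * (n * unitErr m n)) * sizeParam X v t₁ t₂ ≤ 1 / 100 * sizeParam X v t₁ t₂ := by
    linarith
  linarith [le_of_mul_le_mul_right h5 hS]

/-- The shifted CholeskyQR step applied to a `T₁` matrix. -/
theorem IsT1Matrix.sCholeskyQR_bounds {m n v t₁ t₂ : ℕ} {X : Matrix (Fin m) (Fin n) ℝ} {s : ℝ}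
    (hX : IsT1Matrix X v t₁ t₂) (hrank : X.rank = n)
    (hs : minShift X v t₁ t₂ ≤ s ∧ s ≤ phiParam X v t₁ t₂)
    (hκ : 4 * (n : ℝ) ^ 2 * u * (hParam m n v * lParam X t₁ * cond2 X) ≤ 1) :
    ¬ SCholeskyQRBreaksDown X s ∧ ∀ W Y, SCholeskyQR X s W Y → ∀ z,
      sq (W.mulVec z) ≤ 1.78 * sq z ∧
      sq z ≤ 2 * (1 + s / sigmaMin X ^ 2) * sq (W.mulVec z) := by
  obtain ⟨hn, hm, hN, hσ, hS, hs0, hε, h11, hns, hst⟩ := hX.shift_facts hrank hs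
  have hn' : (2 : ℝ) ≤ n := by exact_mod_cast hn
  have hε0 : 0 < unitErr m n := by
    rw [unitErr_eq]; exact mul_pos (by positivity) u_pos
  have hε1 : unitErr m n ≤ 1 / 2000 := by nlinarith
  have hx1 : sq (colScale X s) ≤ 1.01 * sizeParam X v t₁ t₂ := by
    rw [sq_colScale X hs0.le, Finset.sum_add_distrib]
    have := hX.sum_sq_le
    simp only [Finset.sum_const, Finset.card_univ, Fintype.card_fin, nsmul_eq_mul]
    linarith
  have hx2 : sq (colScale X s) ≤ n * (1.01 * (t₁ * maxAbsEntry X ^ 2)) := by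
    rw [sq_colScale X hs0.le]
    have := Finset.sum_le_sum fun j (_ : j ∈ Finset.univ) =>
      show ∑ i, X i j ^ 2 + s ≤ 1.01 * (t₁ * maxAbsEntry X ^ 2) by linarith [hX.col_le j]
    simpa using this
  -- This is where the `11` in the shift enters: `1.25 * 1.01 / 11 < 0.12`.
  have hT : 1.25 * unitErr m n * sq (colScale X s) ≤ 0.12 * s := by
    have := mul_le_mul_of_nonneg_left hx1 hε0.le
    linarith
  have hc : 0 ≤ maxAbsEntry X := Real.iSup_nonneg fun _ => abs_nonneg _
  -- The assumption on `κ₂(X)` is `4n²u h c√t₁ ≤ σ_min(X)`. Squared, with `h² ≥ 2.23`, it suffices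
  -- because `1.01 / (16 * 2.23) < 0.0289`.
  have hF : (n * u) ^ 2 * n * sq (colScale X s) ≤ 0.0289 * sigmaMin X ^ 2 := by
    have hu := u_pos
    have hh := hParam_pos (m := m) (n := n) (v := v)
    have h1 : 4 * (n : ℝ) ^ 2 * u * hParam m n v * (maxAbsEntry X * √t₁) ≤ sigmaMin X := by
      have : 4 * (n : ℝ) ^ 2 * u * (hParam m n v * lParam X t₁ * cond2 X)
          = 4 * (n : ℝ) ^ 2 * u * hParam m n v * (maxAbsEntry X * √t₁) / sigmaMin X := by
        unfold lParam cond2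
        field_simp
      rw [this, div_le_one hσ] at hκ
      exact hκ
    have h2 := pow_le_pow_left₀ (by positivity) h1 2
    rw [mul_pow, mul_pow, mul_pow (maxAbsEntry X), Real.sq_sqrt (Nat.cast_nonneg _)] at h2
    have h3 : ((n : ℝ) * u) ^ 2 * n * sq (colScale X s)
        ≤ (n * u) ^ 2 * n * (n * (1.01 * (t₁ * maxAbsEntry X ^ 2))) :=
      mul_le_mul_of_nonneg_left hx2 (by positivity)
    set w := ((n : ℝ) ^ 2 * u) ^ 2 * (maxAbsEntry X ^ 2 * t₁) with hw
    have hw0 : 0 ≤ w := by positivity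
    have h4 : 16 * hParam m n v ^ 2 * w ≤ sigmaMin X ^ 2 := by
      refine le_trans (le_of_eq ?_) h2
      rw [hw]; ring
    have h5 : 2.23 * w ≤ hParam m n v ^ 2 * w := mul_le_mul_of_nonneg_right hParam_sq hw0
    have h6 : ((n : ℝ) * u) ^ 2 * n * (n * (1.01 * (t₁ * maxAbsEntry X ^ 2))) = 1.01 * w := by
      rw [hw]; ring
    linarith
  have hXσ := sigmaMin_sq_mul_le X
  -- Positive definiteness is taken from the shift alone, `μ = s`; `σ_min(X)²` serves only as `a`,
  -- for the substitution error.
  have key : ∀ G A, FlMul X.transpose X G → FlShift G s A → _ := fun G A hG hA =>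
    (approxGram_of_flShift hs0.le hG hA).choleskyQR_step hε1 hm hn hs0.le hs0
      (by positivity : 0 < sigmaMin X ^ 2)
      (fun y => by linarith [sq_fun_nonneg (X.mulVec y)]) hXσ hT hF
  exact ⟨fun ⟨G, A, hG, hA, hbd⟩ => (key G A hG hA).1 hbd,
    fun W Y ⟨G, A, hG, hA, hY, hW⟩ => (key G A hG hA).2 Y W hY hW⟩

end SparseCholeskyQR

/-! ### The main theorem. -/

open SparseCholeskyQR
theorem mainTheorem1 {m n : ℕ} (X : Matrix (Fin m) (Fin n) ℝ) (v t₁ t₂ : ℕ) (s : ℝ)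
    (hX : IsT1Matrix X v t₁ t₂) (hrank : X.rank = n)
    (hs : minShift X v t₁ t₂ ≤ s ∧ s ≤ phiParam X v t₁ t₂)
    (hκ : 4 * (n : ℝ) ^ 2 * u * (hParam m n v * lParam X t₁ * cond2 X) ≤ 1) :
    (¬ SCholeskyQRBreaksDown X s ∧
      ∀ W Y, SCholeskyQR X s W Y →
        W.rank = n ∧
        cond2 W ≤ 2 * hParam m n v * √(1 + s / norm2 X ^ 2 * cond2 X ^ 2)) ∧
    (s = minShift X v t₁ t₂ →
      s / norm2 X ^ 2 = 11 * (m * u + (n + 1) * u) * kParam X v t₁ t₂ ∧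
      (cond2 X ≤ 1 / (16 * √(11 * n * kParam X v t₁ t₂) * (m * u + (n + 1) * u) * hParam m n v) →
        ¬ SCholeskyQR3BreaksDown X s ∧
        ∀ W Y, SCholeskyQR X s W Y →
          cond2 W ≤ 1 / (8 * √(m * n * u + n * (n + 1) * u)))) := by
  obtain ⟨hbd, hW⟩ := hX.sCholeskyQR_bounds hrank hs hκ
  obtain ⟨hn, hm, hN, hσ, hS, hs0, hε, -, -, -⟩ := hX.shift_facts hrank hs
  have hh := hParam_pos (m := m) (n := n) (v := v)
  have hh2 := hParam_sq (m := m) (n := n) (v := v)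
  have hα : s / norm2 X ^ 2 * cond2 X ^ 2 = s / sigmaMin X ^ 2 := by
    unfold cond2; field_simp
  set q := s / sigmaMin X ^ 2 with hq
  have hq0 : 0 < q := by positivity
  have hcond : ∀ W Y, SCholeskyQR X s W Y → 0 < sigmaMin W ∧ cond2 W ^ 2 ≤ 3.56 * (1 + q) := by
    intro W Y h
    obtain ⟨h1, h2⟩ := cond2_sq_le (by omega) (by norm_num) (by positivity) (hW W Y h)
    exact ⟨h1, by linarith⟩
  refine ⟨⟨hbd, fun W Y h => ⟨rank_eq_of_sigmaMin_pos (hcond W Y h).1, ?_⟩⟩, fun hsm => ⟨?_, ?_⟩⟩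
  · refine le_of_sq_le_sq ?_ (by positivity)
    rw [hα, mul_pow, mul_pow, Real.sq_sqrt (by positivity)]
    nlinarith [(hcond W Y h).2]
  · rw [hsm, minShift, kParam, mul_div_assoc]
  · intro hκ2
    have hε0 : 0 < unitErr m n := by
      rw [unitErr_eq]; exact mul_pos (by positivity) u_pos
    have hn0 : 0 < (n : ℝ) := by positivity
    have hk : 0 < kParam X v t₁ t₂ := by unfold kParam; positivity
    -- The squared hypothesis reads `256 n ε q h² ≤ 1` with `ε = unitErr m n`. Together with `n ε ≤
    -- 1 / 1100` and `h² ≥ 2.23` it bounds both parts of `n ε (1 + q)`. The result yields the bound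
    -- on `κ₂(W)` and the hypothesis of `not_choleskyQR2BreaksDown`, as `3.56 = 1.78 * 2`.
    have hqε : 64 * (n * unitErr m n) * (3.56 * (1 + q)) ≤ 1 := by
      have h1 : cond2 X * (16 * √(11 * n * kParam X v t₁ t₂) * unitErr m n * hParam m n v) ≤ 1 :=
        (le_div_iff₀ (by change 0 < 16 * _ * unitErr m n * _; positivity)).1 hκ2
      have h2 := pow_le_pow_left₀ (mul_nonneg (cond2_nonneg X) (by positivity)) h1 2
      rw [mul_pow, mul_pow, mul_pow, mul_pow, Real.sq_sqrt (by positivity)] at h2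
      have h3 : q = 11 * unitErr m n * kParam X v t₁ t₂ * cond2 X ^ 2 := by
        rw [← hα, hsm, minShift, kParam, mul_div_assoc]; rfl
      have h4 : 256 * (n * unitErr m n * q) * hParam m n v ^ 2 ≤ 1 := by
        refine le_trans (le_of_eq ?_) (h2.trans_eq (one_pow 2))
        rw [h3]; ring
      have h5 : 0 ≤ n * unitErr m n * q := by positivity
      nlinarith
    refine ⟨?_, fun W Y h => ?_⟩
    · rintro (h | ⟨W, Y, h, h'⟩)
      · exact hbd h
      · refine not_choleskyQR2BreaksDown hε hm hn (a := (2 * (1 + q))⁻¹) (b := 1.78)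
          (by positivity) (fun y => ?_) (fun y => (hW W Y h y).1) ?_ h'
        · rw [inv_mul_le_iff₀ (by positivity)]
          exact (hW W Y h y).2
        · rw [inv_eq_one_div, le_div_iff₀ (by positivity)]
          linarith
    · have h1 : (m : ℝ) * n * u + n * (n + 1) * u = n * unitErr m n := by unfold unitErr; ring
      rw [h1, le_div_iff₀ (by positivity)]
      refine le_of_sq_le_sq ?_ (by norm_num)
      rw [mul_pow, mul_pow, Real.sq_sqrt (by positivity), one_pow]
      have := mul_le_mul_of_nonneg_left (hcond W Y h).2
        (by positivity : 0 ≤ 64 * (n * unitErr m n))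
      linarith
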